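/- \textbf{Conventions.} Graphs are finite multigraphs, with loops and parallel edges allowed. Each edge consists of two half-edges, each incident on one vertex. A graph is 4-regular if every vertex is incident on exactly four half-edges. A circuit is a nonempty closed trail, considered up to cyclic permutation. An Euler system of $F$ is a choice of one Euler circuit in each connected component of $F$. A circuit partition of $F$ is a set of pairwise edge-disjoint circuits that together contain every edge of $F$. The number of connected components of $F$ is $c(F)$. Let $F$ be a 4-regular graph, $C$ an Euler system of $F$, and $P$ a circuit partition of $F$. \emph{Transitions.} A transition at a vertex $v$ is a partition of the four half-edges at $v$ into two pairs. The transition $P(v)$ consists of the pairs of half-edges along which circuits of $P$ enter and then leave $v$. If the circuit of $C$ through $v$ enters $v$ along $a$ and leaves along $b$, and on its other passage enters along $a'$ and leaves along $b'$, then $\phi_C(v)=\{\{a,b\},\{a',b'\}\}$, $\chi_C(v)=\{\{a,b'\},\{a',b\}\}$ and $\psi_C(v)=\{\{a,a'\},\{b,b'\}\}$. \emph{Modified interlacement matrix.} Vertices $v\neq w$ are interlaced if they appear in the cyclic order $vwvw$ on some circuit of $C$. $M(C,P)$ is the $V(F)\times V(F)$ matrix over $GF(2)$ obtained as follows from the matrix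 whose $vw$ entry is $1$ exactly when $v\neq w$ are interlaced: if $P(v)=\phi_C(v)$, change the $vv$ entry to $1$ and every other entry of the $v$ column to $0$; if $P(v)=\psi_C(v)$, change the $vv$ entry to $1$. \emph{Touch-graph.} $Tch(P)$ has one vertex for each circuit in $P$ and one edge $e_v$ for each $v\in V(F)$; the ends of $e_v$ are the circuits of $P$ that pass through $v$ (so $e_v$ is a loop if there is only one). Let $D$ be any directed version of $Tch(P)$. For a closed walk $W$ in $Tch(P)$, the $e$ coordinate of $z_D(W)\in\mathbb{R}^{E(Tch(P))}$ is the number of times $W$ passes through $e$ in the $D$ direction minus the number of times it does so in the opposite direction. The cycle space $Z_D(Tch(P))$ over $\mathbb{R}$ is the span of all the vectors $z_D(W)$. Identify $\mathbb{R}^{E(Tch(P))}$ with $\mathbb{R}^{V(F)}$ through $e_v\leftrightarrow v$. \textbf{Theorem.} For every directed version $D$ of $Tch(P)$ there is a $V(F)\times V(F)$ matrix $M_{\mathbb{R}}(C,P)$ with integer entries such that 1. $M_{\mathbb{R}}(C,P)$ reduces modulo $2$ to $M(C,P)$; 2. the row space of $M_{\mathbb{R}}(C,P)$ over $\mathbb{R}$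 is the cycle space $Z_D(Tch(P))$ over $\mathbb{R}$. Moreover, every integer matrix with these two properties has $\mathbb{R}$-nullity $|P|-c(F)$. -/

import Mathlib

/-- A multigraph (loops and parallel edges allowed) with vertex set `V` and set of half-edges `H`.
Each half-edge is incident on one vertex, and the edges are the pairs `{h, opp h}`,
where `opp` is an involution without fixed points. -/
structure HalfEdgeGraph (V H : Type*) where
  /-- the vertex on which a half-edge is incident -/
  vert : H → V
  /-- the other half-edge of the same edge -/
  opp : H → H
  opp_opp : ∀ h, opp (opp h) = h
  opp_ne : ∀ h, opp h ≠ h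

namespace HalfEdgeGraph

variable {V H : Type*} (F : HalfEdgeGraph V H)

/-- Every vertex is incident on exactly four half-edges. -/
def IsFourRegular : Prop :=
  ∀ v : V, {h : H | F.vert h = v}.ncard = 4

/-- Two vertices are adjacent if some edge joins them. -/
def Adj (v w : V) : Prop :=
  ∃ h : H, F.vert h = v ∧ F.vert (F.opp h) = w

/-- The connected components: `V` modulo the equivalence relation generated by adjacency. -/
def Component : Type _ := Quot F.Adj

/-- The connected component that contains a vertex. -/
def component (v : V) : F.Component := Quot.mk F.Adj v

/-- The number `c(F)` of connected components. -/
noncomputable def numComponents : ℕ := Nat.card F.Component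

/-- A circuit, i.e. a nonempty closed trail, with its orientation, up to cyclic permutation.
It is recorded by the cyclic sequence `h₁, h₂, …, hₖ` of the initial half-edges of its steps:
the `i`-th step runs along the edge `{hᵢ, opp hᵢ}` from `vert hᵢ` to `vert (opp hᵢ)`. -/
structure Circuit where
  steps : Cycle H
  ne_nil : steps ≠ Cycle.nil
  /-- each step ends at the vertex where the next step begins -/
  chain : steps.Chain fun x y => F.vert (F.opp x) = F.vert y
  /-- no edge is traversed twice in the same direction -/
  nodup : steps.Nodup
  /-- no edge is traversed in both directions -/
  opp_notMem : ∀ h ∈ steps, F.opp h ∉ steps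

namespace Circuit

variable {F}

/-- The circuit traverses the edge `{h, opp h}` (in one of the two directions). -/
def Traverses (γ : F.Circuit) (h : H) : Prop :=
  h ∈ γ.steps ∨ F.opp h ∈ γ.steps

/-- The circuit passes through the vertex `v`. -/
def PassesThrough (γ : F.Circuit) (v : V) : Prop :=
  ∃ h ∈ γ.steps, F.vert h = v

/-- Somewhere on `γ`, the vertex `v` is entered along the half-edge `a` and then immediately left
along the half-edge `b`. -/
def Passage [DecidableEq H] (γ : F.Circuit) (v : V) (a b : H) : Prop :=
  ∃ (x : H) (hx : x ∈ γ.steps),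
    a = F.opp x ∧ b = γ.steps.next γ.nodup x hx ∧ F.vert a = v

/-- The cyclic sequence of the vertices met along the circuit. -/
def vertices (γ : F.Circuit) : Cycle V :=
  γ.steps.map F.vert

/-- `γ` is an Euler circuit of the connected component `K`: it traverses exactly the edges
of `K`. -/
def IsEulerCircuit (γ : F.Circuit) (K : F.Component) : Prop :=
  ∀ h : H, γ.Traverses h ↔ F.component (F.vert h) = K

end Circuit

/-- An Euler system: a choice of one Euler circuit in each connected component. -/
structure EulerSystem where
  circuit : F.Component → F.Circuit
  isEulerCircuit : ∀ K, (circuit K).IsEulerCircuit K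

/-- A circuit partition: a set of circuits such that every edge is traversed by exactly one of
them. -/
structure CircuitPartition where
  circuits : Finset F.Circuit
  existsUnique : ∀ h : H, ∃! γ, γ ∈ circuits ∧ γ.Traverses h

variable {F}

/-- The transition `P(v)`: the set of the single transitions (unordered pairs of half-edges at `v`)
which the circuits of `P` use when passing through `v`. -/
def CircuitPartition.transition [DecidableEq H] (P : F.CircuitPartition) (v : V) : Set (Sym2 H) :=
  {s | ∃ γ ∈ P.circuits, ∃ a b, γ.Passage v a b ∧ s = s(a, b)}

namespace EulerSystem

variable (C : F.EulerSystem)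

/-- Some circuit of `C` enters `v` along `a` and then leaves it along `b`. -/
def Passage [DecidableEq H] (v : V) (a b : H) : Prop :=
  ∃ K, (C.circuit K).Passage v a b

/-- The transition `φ_C(v)`: follow the circuit of `C` that passes through `v`. -/
def phi [DecidableEq H] (v : V) : Set (Sym2 H) :=
  {s | ∃ a b, C.Passage v a b ∧ s = s(a, b)}

/-- The transition `ψ_C(v)`, inconsistent with the orientation of the circuit of `C` through `v`:
if `(a, b)` and `(a', b')` are the two passages of `C` through `v`, then the two incoming half-edges
`a`, `a'` are paired, and so are the two outgoing half-edges `b`, `b'`. (The third transition at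
`v`, usually called `χ_C(v)`, pairs `a` with `b'` and `a'` with `b`.) -/
def psi [DecidableEq H] (v : V) : Set (Sym2 H) :=
  {s | ∃ a b a' b', C.Passage v a b ∧ C.Passage v a' b' ∧ (a, b) ≠ (a', b') ∧
    (s = s(a, a') ∨ s = s(b, b'))}

/-- `v ≠ w` are interlaced with respect to `C`: on some circuit of `C` they appear in the cyclic
order `v w v w` or `w v w v`. -/
def Interlaced (v w : V) : Prop :=
  v ≠ w ∧ ∃ (K : F.Component) (l : List V), (l : Cycle V) = (C.circuit K).vertices ∧
    (List.Sublist [v, w, v, w] l ∨ List.Sublist [w, v, w, v] l)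

open Classical in
/-- The interlacement matrix `I(C)` over `GF(2)`. -/
noncomputable def interlacementMatrix : Matrix V V (ZMod 2) :=
  fun v w => if C.Interlaced v w then 1 else 0

open Classical in
/-- The modified interlacement matrix `M(C, P)` over `GF(2)`: if `P` involves `φ_C(w)`, then
the `w` column of `I(C)` is replaced by the `w` column of the identity matrix; if `P` involves
`ψ_C(w)`, then the `ww` entry is changed to `1`. -/
noncomputable def modifiedInterlacementMatrix [DecidableEq H] (P : F.CircuitPartition) :
    Matrix V V (ZMod 2) :=
  fun v w =>
    if P.transition w = C.phi w then (if v = w then 1 else 0)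
    else if P.transition w = C.psi w ∧ v = w then 1
    else C.interlacementMatrix v w

end EulerSystem

/-- The touch-graph `Tch(P)`: it has a vertex for each circuit `γ ∈ P` and an edge `e_v` for each
vertex `v` of `F` (the edge `e_v` is `v` itself); the ends of `e_v` are the circuits of `P` that
pass through `v`. It is a loop when only one circuit of `P` passes through `v`. -/
def CircuitPartition.touchGraph (P : F.CircuitPartition) : Graph F.Circuit V where
  vertexSet := {γ | γ ∈ P.circuits}
  IsLink v γ γ' := ∀ δ : F.Circuit, (δ ∈ P.circuits ∧ δ.PassesThrough v) ↔ (δ = γ ∨ δ = γ')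
  isLink_symm := fun _ _ => ⟨fun _ _ h δ => (h δ).trans or_comm⟩
  eq_or_eq_of_isLink_of_isLink := fun _ _ _ _ _ h h' => (h' _).1 ((h _).2 (Or.inl rfl))
  left_mem_of_isLink := fun _ x _ h => ((h x).2 (Or.inl rfl)).1

end HalfEdgeGraph

namespace Graph

variable {α β : Type*} (G : Graph α β)

/-- A directed version of a multigraph: each edge `e` is directed from `src e` to `tgt e`.
(The values on labels that are not edges are irrelevant.) -/
structure DirectedVersion where
  src : β → α
  tgt : β → α
  isLink : ∀ e ∈ G.edgeSet, G.IsLink e (src e) (tgt e)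

namespace DirectedVersion

variable {G} (D : G.DirectedVersion)

/-- The vertex where a step of a walk begins. The step `(e, true)` passes through the edge `e` in
the `D` direction, the step `(e, false)` in the opposite direction. -/
def start (s : β × Bool) : α := if s.2 then D.src s.1 else D.tgt s.1

/-- The vertex where a step of a walk ends. -/
def finish (s : β × Bool) : α := if s.2 then D.tgt s.1 else D.src s.1

/-- A list of steps is a closed walk if all steps use edges of `G`, each step ends where the next
one begins, and the last step ends where the first one begins. -/
def IsClosedWalk (W : List (β × Bool)) : Prop :=
  (∀ s ∈ W, s.1 ∈ G.edgeSet) ∧ (W : Cycle (β × Bool)).Chain fun s t => D.finish s = D.start t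

end DirectedVersion

/-- The vector `z_D(W)`: its `e` coordinate is the number of times that `W` passes through `e` in
the `D` direction, minus the number of times that it passes through `e` in the opposite
direction. -/
def walkVector (𝕜 : Type*) [Field 𝕜] [DecidableEq β] (W : List (β × Bool)) : β → 𝕜 :=
  fun e => (W.count (e, true) : 𝕜) - (W.count (e, false) : 𝕜)

/-- The cycle space `Z_D(G)` over `𝕜`: the span of the vectors of all closed walks. -/
def DirectedVersion.cycleSpace {G : Graph α β} (D : G.DirectedVersion) (𝕜 : Type*) [Field 𝕜]
    [DecidableEq β] : Submodule 𝕜 (β → 𝕜) :=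
  Submodule.span 𝕜 {z | ∃ W : List (β × Bool), D.IsClosedWalk W ∧ z = walkVector 𝕜 W}

end Graph

/-!
The modified interlacement matrix over `GF(2)` is lifted to the integers row by row, with vectors of
closed walks in the touch-graph as rows, and the rank of the lift is bounded from below by its rank
modulo `2`.

*The transitions.* A circuit partition `P` is encoded by the fixed point free involution `P.turn`
on the half-edges that exchanges the two half-edges of each passage. There are three such
involutions of the four half-edges at a vertex, which makes it easy to tell `φ`, `χ` and `ψ` apart
(`transition_eq_phi_iff`, `transition_eq_psi_iff`).

*The rows.* The two passages of the Euler circuit through `v` divide it into two closed trails. Each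
edge of such a trail lies on a circuit of `P`, so the trail is accompanied by a closed walk in the
touch-graph, which uses `e_w` whenever the trail passes through `w` along two half-edges that `P`
does not pair. At a vertex `w ≠ v` this happens at every visit unless `P(w) = φ(w)`, and the number
of visits is odd exactly when `v` and `w` are interlaced; at `v` it happens unless `P(v) = χ(v)`.
Hence the vector of this walk reduces modulo `2` to row `v` of the modified interlacement matrix
(`exists_closedWalk`), and the row space of the lift lies in the cycle space, whatever directions
are chosen for loops.

*The rank.* Let `x` be in the kernel of the modified interlacement matrix over `GF(2)`. Since every
vertex is visited twice, there is a function `f` on the edges that changes by `x v` whenever an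
Euler circuit passes through a vertex `v` with `P(v) ≠ φ(v)`, and does not change at the other
passages (`exists_potential`). The equation for row `v` says exactly that `f` is constant along the
passages of `P` at `v`, and that its values on the two circuits of `P` at `v` differ by `x v`. So
`x` is a coboundary of the touch-graph (`ker_modifiedInterlacementMatrix_le`). Over every field the
coboundaries form a space of dimension `|P| - c(F)` (`rank_coboundary_add_numComponents`) that is
orthogonal to the cycle space. As the real rank of an integer matrix is at least its rank modulo
`2` (`Matrix.rank_map_zmod_le`), the rows of the lift span the cycle space, and its dimension
`|V| - |P| + c(F)` determines the nullity of every matrix with this row space.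
-/

/-! ### Successors in a cyclic sequence -/

namespace Cycle

variable {α : Type*}

theorem exists_eq_coe_cons_of_mem {s : Cycle α} {x : α} (hx : x ∈ s) :
    ∃ l : List α, s = ((x :: l : List α) : Cycle α) := by
  induction s using Cycle.induction_on with
  | nil => exact (Cycle.notMem_nil x hx).elim
  | cons a l _ =>
    obtain ⟨s, t, h⟩ := List.append_of_mem (Cycle.mem_coe_iff.1 hx)
    refine ⟨t ++ s, ?_⟩
    rw [h, Cycle.coe_eq_coe, ← List.cons_append]
    exact List.isRotated_append

theorem Chain.rel_next [DecidableEq α] {r : α → α → Prop} {s : Cycle α} (h : s.Chain r)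
    (hs : s.Nodup) {x : α} (hx : x ∈ s) : r x (s.next hs x hx) := by
  obtain ⟨l, rfl⟩ := exists_eq_coe_cons_of_mem hx
  rw [Cycle.chain_coe_cons] at h
  cases l with
  | nil => exact (List.isChain_cons_cons.1 h).1
  | cons y l =>
    have : Cycle.next ((x :: y :: l : List α) : Cycle α) hs x hx = y :=
      List.next_cons_cons_eq _ _ y hx
    rw [this]
    exact (List.isChain_cons_cons.1 h).1

theorem chain_next [DecidableEq α] (s : Cycle α) (hs : s.Nodup) :
    s.Chain fun x y => ∃ hx, s.next hs x hx = y := by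
  induction s using Cycle.induction_on with
  | nil => trivial
  | cons a l _ =>
    rw [Cycle.chain_coe_cons, List.isChain_iff_getElem]
    intro i hi
    have hn : (a :: l).Nodup := hs
    have hlen : i < (a :: l).length := by simpa using hi
    have e1 : (a :: (l ++ [a]))[i] = (a :: l)[i] := by
      simp only [← List.cons_append]
      rw [List.getElem_append_left]
    have e2 : (a :: (l ++ [a]))[i + 1] =
        (a :: l)[(i + 1) % (a :: l).length]'(Nat.mod_lt _ (by simp)) := by
      simp only [← List.cons_append]
      rcases Nat.lt_or_ge (i + 1) (a :: l).length with h | h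
      · rw [List.getElem_append_left h]
        simp only [Nat.mod_eq_of_lt h]
      · have : i + 1 = (a :: l).length := by omega
        rw [List.getElem_append_right h]
        simp [this]
    rw [e1, e2]
    exact ⟨Cycle.mem_coe_iff.2 (List.getElem_mem _), List.next_getElem _ hn i hlen⟩

theorem rel_of_forall_rel_next [DecidableEq α] {r : α → α → Prop} [IsTrans α r] {s : Cycle α}
    (hs : s.Nodup) (h : ∀ x hx, r x (s.next hs x hx)) {x y : α} (hx : x ∈ s) (hy : y ∈ s) :
    r x y :=
  Cycle.chain_iff_pairwise.1
    ((s.chain_next hs).imp fun a _ ⟨ha, hb⟩ => hb ▸ h a ha) x hx y hy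

end Cycle

namespace HalfEdgeGraph

variable {V H : Type*} {F : HalfEdgeGraph V H}

/-! ### Transitions as involutions of the half-edges -/

namespace Circuit

theorem exists_mem (γ : F.Circuit) : ∃ h, h ∈ γ.steps := by
  obtain ⟨s, h, -, -, -⟩ := γ
  induction s using Cycle.induction_on with
  | nil => exact (h rfl).elim
  | cons a l _ => exact ⟨a, by simp⟩

theorem traverses_opp {γ : F.Circuit} {h : H} : γ.Traverses (F.opp h) ↔ γ.Traverses h := by
  simp only [Traverses, F.opp_opp, or_comm]

theorem opp_mem_iff {γ : F.Circuit} {h : H} (ht : γ.Traverses h) :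
    F.opp h ∈ γ.steps ↔ h ∉ γ.steps := by
  constructor
  · intro h1 h2
    exact γ.opp_notMem h h2 h1
  · intro h1
    exact ht.resolve_left h1

variable [DecidableEq H]

theorem vert_next (γ : F.Circuit) {x : H} (hx : x ∈ γ.steps) :
    F.vert (γ.steps.next γ.nodup x hx) = F.vert (F.opp x) :=
  (γ.chain.rel_next γ.nodup hx).symm

/-- The half-edge that `γ` uses together with `h` when it passes through the end of `h`: the one
along which `γ` arrives if it leaves along `h`, and the one along which it leaves if it arrives
along `h`. If `γ` does not traverse `h`, the value is `h`. -/
def turn (γ : F.Circuit) (h : H) : H :=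
  if hx : h ∈ γ.steps then F.opp (γ.steps.prev γ.nodup h hx)
  else if hx : F.opp h ∈ γ.steps then γ.steps.next γ.nodup (F.opp h) hx
  else h

theorem turn_of_mem {γ : F.Circuit} {h : H} (hx : h ∈ γ.steps) :
    γ.turn h = F.opp (γ.steps.prev γ.nodup h hx) := by
  rw [turn, dif_pos hx]

theorem turn_opp {γ : F.Circuit} {h : H} (hx : h ∈ γ.steps) :
    γ.turn (F.opp h) = γ.steps.next γ.nodup h hx := by
  have h1 : F.opp h ∉ γ.steps := γ.opp_notMem h hx
  rw [turn, dif_neg h1, dif_pos (by rwa [F.opp_opp])]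
  congr 1
  exact F.opp_opp h

theorem passage_iff {γ : F.Circuit} {v : V} {a b : H} :
    γ.Passage v a b ↔ F.vert a = v ∧ F.opp a ∈ γ.steps ∧ γ.turn a = b := by
  constructor
  · rintro ⟨x, hx, rfl, rfl, h⟩
    exact ⟨h, by rwa [F.opp_opp], turn_opp hx⟩
  · rintro ⟨h, hx, rfl⟩
    refine ⟨F.opp a, hx, (F.opp_opp a).symm, ?_, h⟩
    rw [← turn_opp hx, F.opp_opp]

theorem turn_mem_iff {γ : F.Circuit} {h : H} (ht : γ.Traverses h) :
    γ.turn h ∈ γ.steps ↔ h ∉ γ.steps := by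
  by_cases hx : h ∈ γ.steps
  · rw [turn_of_mem hx]
    simp only [hx, not_true_eq_false, iff_false]
    exact γ.opp_notMem _ (Cycle.prev_mem ..)
  · have := turn_opp (ht.resolve_left hx)
    rw [F.opp_opp] at this
    simp only [hx, not_false_eq_true, iff_true, this]
    exact Cycle.next_mem ..

theorem turn_turn {γ : F.Circuit} {h : H} (ht : γ.Traverses h) : γ.turn (γ.turn h) = h := by
  by_cases hx : h ∈ γ.steps
  · rw [turn_of_mem hx, turn_opp (Cycle.prev_mem ..), Cycle.next_prev]
  · have h1 := ht.resolve_left hx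
    have := turn_opp h1
    rw [F.opp_opp] at this
    rw [this, turn_of_mem (Cycle.next_mem ..), Cycle.prev_next, F.opp_opp]

theorem traverses_turn {γ : F.Circuit} {h : H} (ht : γ.Traverses h) : γ.Traverses (γ.turn h) := by
  by_cases hx : h ∈ γ.steps
  · right
    rw [turn_of_mem hx, F.opp_opp]
    exact Cycle.prev_mem ..
  · exact Or.inl ((turn_mem_iff ht).2 hx)

theorem vert_turn {γ : F.Circuit} {h : H} (ht : γ.Traverses h) :
    F.vert (γ.turn h) = F.vert h := by
  by_cases hx : h ∈ γ.steps
  · rw [turn_of_mem hx, ← γ.vert_next (Cycle.prev_mem ..), Cycle.next_prev]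
  · have h1 := ht.resolve_left hx
    have := turn_opp h1
    rw [F.opp_opp] at this
    rw [this, γ.vert_next, F.opp_opp]

/-- A function that takes equal values on a half-edge and its opposite, and on the two half-edges
of each passage of `γ`, is constant on the half-edges which `γ` traverses. -/
theorem eq_of_traverses {β : Type*} {γ : F.Circuit} {f : H → β}
    (h_opp : ∀ h, f (F.opp h) = f h) (h_turn : ∀ h, γ.Traverses h → f (γ.turn h) = f h)
    {x y : H} (hx : γ.Traverses x) (hy : γ.Traverses y) : f x = f y := by
  have key : ∀ x y, x ∈ γ.steps → y ∈ γ.steps → f x = f y := by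
    intro x y hx hy
    have : IsTrans H fun x y => f x = f y := ⟨fun _ _ _ => Eq.trans⟩
    refine Cycle.rel_of_forall_rel_next (r := fun x y => f x = f y) γ.nodup (fun x hx => ?_) hx hy
    rw [← turn_opp hx, h_turn _ (traverses_opp.2 (Or.inl hx)), h_opp]
  rcases hx with hx | hx <;> rcases hy with hy | hy
  · exact key _ _ hx hy
  · rw [← h_opp y]; exact key _ _ hx hy
  · rw [← h_opp x]; exact key _ _ hx hy
  · rw [← h_opp x, ← h_opp y]; exact key _ _ hx hy

end Circuit

theorem component_opp (h : H) : F.component (F.vert (F.opp h)) = F.component (F.vert h) :=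
  (Quot.sound ⟨h, rfl, rfl⟩).symm

namespace CircuitPartition

variable (P : F.CircuitPartition)

/-- The circuit of `P` that traverses the half-edge `h`. -/
noncomputable def circ (h : H) : F.Circuit := (P.existsUnique h).choose

theorem circ_mem (h : H) : P.circ h ∈ P.circuits := (P.existsUnique h).choose_spec.1.1

theorem traverses_circ (h : H) : (P.circ h).Traverses h := (P.existsUnique h).choose_spec.1.2

variable {P} in
theorem circ_eq {γ : F.Circuit} (hγ : γ ∈ P.circuits) {h : H} (ht : γ.Traverses h) :
    P.circ h = γ :=
  ((P.existsUnique h).choose_spec.2 γ ⟨hγ, ht⟩).symm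

theorem circ_opp (h : H) : P.circ (F.opp h) = P.circ h :=
  circ_eq (P.circ_mem h) (Circuit.traverses_opp.2 (P.traverses_circ h))

theorem exists_circ_eq {γ : F.Circuit} (hγ : γ ∈ P.circuits) : ∃ h, P.circ h = γ := by
  obtain ⟨h, hh⟩ := γ.exists_mem
  exact ⟨h, circ_eq hγ (Or.inl hh)⟩

/-- The half-edge `h` is directed away from its vertex by the circuit of `P` that traverses it. -/
def Fwd (h : H) : Prop := h ∈ (P.circ h).steps

theorem fwd_opp {h : H} : P.Fwd (F.opp h) ↔ ¬ P.Fwd h := by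
  rw [Fwd, Fwd, circ_opp, Circuit.opp_mem_iff (P.traverses_circ h)]

variable [DecidableEq H]

/-- The half-edge paired with `h` by the transition of `P` at the vertex of `h`. -/
noncomputable def turn (h : H) : H := (P.circ h).turn h

theorem circ_turn (h : H) : P.circ (P.turn h) = P.circ h :=
  circ_eq (P.circ_mem h) (Circuit.traverses_turn (P.traverses_circ h))

theorem turn_turn (h : H) : P.turn (P.turn h) = h := by
  rw [turn, circ_turn, turn, Circuit.turn_turn (P.traverses_circ h)]

theorem fwd_turn {h : H} : P.Fwd (P.turn h) ↔ ¬ P.Fwd h := by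
  rw [Fwd, Fwd, circ_turn, turn, Circuit.turn_mem_iff (P.traverses_circ h)]

theorem turn_ne (h : H) : P.turn h ≠ h := by
  intro e
  have := P.fwd_turn (h := h)
  rw [e] at this
  tauto

theorem vert_turn (h : H) : F.vert (P.turn h) = F.vert h :=
  Circuit.vert_turn (P.traverses_circ h)

theorem eq_of_circ_eq {β : Type*} {f : H → β} (h_opp : ∀ h, f (F.opp h) = f h)
    (h_turn : ∀ h, f (P.turn h) = f h) {x y : H} (h : P.circ x = P.circ y) : f x = f y := by
  refine Circuit.eq_of_traverses (γ := P.circ x) h_opp (fun z hz => ?_) (P.traverses_circ x)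
    (h ▸ P.traverses_circ y)
  rw [← h_turn z, turn, circ_eq (P.circ_mem x) hz]

theorem exists_passage_iff {v : V} {a b : H} :
    (∃ γ ∈ P.circuits, γ.Passage v a b) ↔ F.vert a = v ∧ ¬ P.Fwd a ∧ P.turn a = b := by
  rw [← P.fwd_opp]
  constructor
  · rintro ⟨γ, hγ, h⟩
    obtain ⟨h1, h2, h3⟩ := Circuit.passage_iff.1 h
    have e : P.circ a = γ := circ_eq hγ (Or.inr h2)
    exact ⟨h1, by rwa [Fwd, circ_opp, e], by rwa [turn, e]⟩
  · rintro ⟨h1, h2, h3⟩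
    refine ⟨P.circ a, P.circ_mem a, Circuit.passage_iff.2 ⟨h1, ?_, h3⟩⟩
    rwa [Fwd, circ_opp] at h2

theorem mem_transition_iff {v : V} {x y : H} :
    s(x, y) ∈ P.transition v ↔ F.vert x = v ∧ P.turn x = y := by
  have : s(x, y) ∈ P.transition v ↔
      ∃ a b, (F.vert a = v ∧ ¬ P.Fwd a ∧ P.turn a = b) ∧ s(x, y) = s(a, b) := by
    simp only [← P.exists_passage_iff, transition, Set.mem_ofPred_eq]
    grind
  rw [this]
  constructor
  · rintro ⟨a, b, ⟨h1, -, rfl⟩, h⟩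
    rcases Sym2.eq_iff.1 h with ⟨rfl, rfl⟩ | ⟨rfl, rfl⟩
    · exact ⟨h1, rfl⟩
    · exact ⟨by rw [P.vert_turn, h1], P.turn_turn _⟩
  · rintro ⟨h1, rfl⟩
    by_cases h : P.Fwd x
    · exact ⟨P.turn x, x, ⟨by rw [P.vert_turn, h1], by rw [P.fwd_turn]; tauto, P.turn_turn x⟩,
        Sym2.eq_swap⟩
    · exact ⟨x, _, ⟨h1, h, rfl⟩, rfl⟩

theorem component_eq_of_circ_eq {x y : H} (h : P.circ x = P.circ y) :
    F.component (F.vert x) = F.component (F.vert y) :=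
  P.eq_of_circ_eq (f := fun h => F.component (F.vert h)) component_opp
    (fun h => by rw [P.vert_turn]) h

/-- If `x` and `y` at the same vertex belong to different pairs of `P`, then these two pairs contain
all half-edges at the vertex. -/
theorem fiber_subset (hF : F.IsFourRegular) {x y : H} (hxy : F.vert y = F.vert x) (h1 : y ≠ x)
    (h2 : y ≠ P.turn x) {z : H} (hz : F.vert z = F.vert x) :
    z = x ∨ z = P.turn x ∨ z = y ∨ z = P.turn y := by
  have h3 : P.turn y ≠ x := fun e => h2 (by rw [← e, P.turn_turn])
  have h4 : P.turn y ≠ P.turn x := fun e => h1 (by rw [← P.turn_turn x, ← e, P.turn_turn])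
  have hcard := hF (F.vert x)
  have hsub : ({x, P.turn x, y, P.turn y} : Set H) ⊆ {h | F.vert h = F.vert x} := by
    rintro z (rfl | rfl | rfl | rfl) <;> simp [P.vert_turn, hxy]
  have h5 : ({x, P.turn x, y, P.turn y} : Set H).ncard = 4 := by
    rw [Set.ncard_insert_of_notMem, Set.ncard_insert_of_notMem, Set.ncard_pair]
    · exact (P.turn_ne y).symm
    · simp [h2.symm, h4.symm]
    · simp [(P.turn_ne x).symm, h1.symm, h3.symm]
  have := Set.eq_of_subset_of_ncard_le hsub (by rw [hcard, h5])
    (Set.finite_of_ncard_ne_zero (by rw [hcard]; norm_num))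
  have hz' : z ∈ {h | F.vert h = F.vert x} := hz
  rw [← this] at hz'
  simpa using hz'

theorem exists_other (hF : F.IsFourRegular) (x : H) :
    ∃ y, F.vert y = F.vert x ∧ y ≠ x ∧ y ≠ P.turn x := by
  by_contra! hcon
  have hcard := hF (F.vert x)
  have hsub : {h | F.vert h = F.vert x} ⊆ ({x, P.turn x} : Set H) := by
    intro z hz
    by_cases h : z = x
    · simp [h]
    · simp [hcon z hz h]
  have h1 := Set.ncard_le_ncard hsub
  have h2 := Set.ncard_insert_le x ({P.turn x} : Set H)
  rw [Set.ncard_singleton] at h2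
  omega

end CircuitPartition

theorem IsFourRegular.exists_vert_eq (hF : F.IsFourRegular) (v : V) : ∃ h, F.vert h = v := by
  have h : {h : H | F.vert h = v}.Nonempty := by
    rw [Set.nonempty_iff_ne_empty]
    intro h
    have := hF v
    simp [h] at this
  exact h

namespace EulerSystem

variable (C : F.EulerSystem)

open Classical in
/-- The circuits of an Euler system form a circuit partition. -/
noncomputable def toCircuitPartition [Finite V] : F.CircuitPartition where
  circuits := (Set.finite_range (α := F.Circuit)
    (ι := Quot F.Adj) C.circuit).toFinset
  existsUnique h := by
    refine ⟨C.circuit (F.component (F.vert h)), ⟨?_, (C.isEulerCircuit _ h).2 rfl⟩, ?_⟩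
    · rw [Set.Finite.mem_toFinset]
      exact ⟨_, rfl⟩
    · rintro γ ⟨hγ, ht⟩
      rw [Set.Finite.mem_toFinset] at hγ
      obtain ⟨K, rfl⟩ := hγ
      rw [(C.isEulerCircuit K h).1 ht]

variable [Finite V]

theorem mem_toCircuitPartition {γ : F.Circuit} :
    γ ∈ C.toCircuitPartition.circuits ↔ ∃ K, C.circuit K = γ := by
  simp only [toCircuitPartition, Set.Finite.mem_toFinset]
  rfl

theorem circ_toCircuitPartition (h : H) :
    C.toCircuitPartition.circ h = C.circuit (F.component (F.vert h)) :=
  CircuitPartition.circ_eq (C.mem_toCircuitPartition.2 ⟨_, rfl⟩) ((C.isEulerCircuit _ h).2 rfl)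

variable [DecidableEq H]

theorem passage_iff {v : V} {a b : H} : C.Passage v a b ↔
    F.vert a = v ∧ ¬ C.toCircuitPartition.Fwd a ∧ C.toCircuitPartition.turn a = b := by
  rw [← CircuitPartition.exists_passage_iff]
  simp only [mem_toCircuitPartition, Passage]
  grind

theorem mem_phi_iff {v : V} {x y : H} :
    s(x, y) ∈ C.phi v ↔ F.vert x = v ∧ C.toCircuitPartition.turn x = y := by
  rw [← CircuitPartition.mem_transition_iff]
  simp only [phi, CircuitPartition.transition, Passage, Set.mem_ofPred_eq, mem_toCircuitPartition]
  grind

theorem mem_psi_iff {v : V} {x y : H} :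
    s(x, y) ∈ C.psi v ↔ F.vert x = v ∧ F.vert y = v ∧ x ≠ y ∧
      (C.toCircuitPartition.Fwd x ↔ C.toCircuitPartition.Fwd y) := by
  set Q := C.toCircuitPartition with hQ
  simp only [psi, passage_iff, Set.mem_ofPred_eq, ← hQ]
  constructor
  · rintro ⟨a, b, a', b', ⟨h1, h2, rfl⟩, ⟨h3, h4, rfl⟩, hne, h⟩
    have hne : a ≠ a' := fun e => hne (by rw [e])
    have hne' : Q.turn a ≠ Q.turn a' := fun e => hne (by rw [← Q.turn_turn a, e, Q.turn_turn])
    have h5 := Q.vert_turn a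
    have h6 := Q.vert_turn a'
    have h7 := Q.fwd_turn (h := a)
    have h8 := Q.fwd_turn (h := a')
    rcases h with h | h <;> rcases Sym2.eq_iff.1 h with ⟨rfl, rfl⟩ | ⟨rfl, rfl⟩ <;> grind
  · rintro ⟨h1, h2, h3, h4⟩
    by_cases h : Q.Fwd x
    · refine ⟨Q.turn x, x, Q.turn y, y, ⟨by rw [Q.vert_turn, h1], ?_, Q.turn_turn x⟩,
        ⟨by rw [Q.vert_turn, h2], ?_, Q.turn_turn y⟩, by simp [h3], Or.inr rfl⟩
      · rw [Q.fwd_turn]; tauto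
      · rw [Q.fwd_turn]; tauto
    · exact ⟨x, _, y, _, ⟨h1, h, rfl⟩, ⟨h2, by tauto, rfl⟩, by simp [h3], Or.inl rfl⟩

theorem transition_eq_phi_iff (hF : F.IsFourRegular) (P : F.CircuitPartition) {x : H} :
    P.transition (F.vert x) = C.phi (F.vert x) ↔
      P.turn x = C.toCircuitPartition.turn x := by
  set Q := C.toCircuitPartition with hQ
  constructor
  · intro h
    have h1 : s(x, P.turn x) ∈ P.transition (F.vert x) := P.mem_transition_iff.2 ⟨rfl, rfl⟩
    rw [h, mem_phi_iff] at h1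
    exact h1.2.symm
  · intro h
    have key : ∀ y, F.vert y = F.vert x → P.turn y = Q.turn y := by
      intro y hy
      by_cases h1 : y = x
      · rw [h1, h]
      by_cases h2 : y = P.turn x
      · rw [h2, P.turn_turn, h, Q.turn_turn]
      have := Q.fiber_subset hF hy h1 (h ▸ h2) (z := P.turn y) (by rw [P.vert_turn, hy])
      have e1 := P.turn_turn y
      have e2 := P.turn_turn x
      have e3 := P.turn_ne y
      grind
    ext s
    induction s using Sym2.ind with
    | _ p q =>
      rw [CircuitPartition.mem_transition_iff, mem_phi_iff]
      constructor
      · rintro ⟨h1, h2⟩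
        exact ⟨h1, by rw [← hQ, ← key p h1, h2]⟩
      · rintro ⟨h1, h2⟩
        exact ⟨h1, by rw [key p h1, hQ, h2]⟩

theorem transition_eq_psi_iff (hF : F.IsFourRegular) (P : F.CircuitPartition) {x : H} :
    P.transition (F.vert x) = C.psi (F.vert x) ↔
      (C.toCircuitPartition.Fwd (P.turn x) ↔ C.toCircuitPartition.Fwd x) := by
  set Q := C.toCircuitPartition with hQ
  constructor
  · intro h
    have h1 : s(x, P.turn x) ∈ P.transition (F.vert x) := P.mem_transition_iff.2 ⟨rfl, rfl⟩
    rw [h, mem_psi_iff] at h1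
    exact h1.2.2.2.symm
  · intro h
    obtain ⟨z, hz⟩ : ∃ z, P.turn x = z := ⟨_, rfl⟩
    have hzv : F.vert z = F.vert x := by rw [← hz, P.vert_turn]
    have hzx : z ≠ x := by rw [← hz]; exact P.turn_ne x
    have hQx := Q.fwd_turn (h := x)
    have hQz := Q.fwd_turn (h := z)
    have hzQ : z ≠ Q.turn x := by
      rintro rfl
      rw [hz] at h
      tauto
    have hfib := fun {w} => Q.fiber_subset hF hzv hzx hzQ (z := w)
    -- the two remaining half-edges at the vertex are paired as well
    have hz2 : P.turn z = x := by rw [← hz, P.turn_turn]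
    have hv1 := Q.vert_turn x
    have hv2 : F.vert (Q.turn z) = F.vert x := by rw [Q.vert_turn, hzv]
    have hw : P.turn (Q.turn x) = Q.turn z := by
      have := hfib (w := P.turn (Q.turn x)) (by rw [P.vert_turn, hv1])
      have e1 := P.turn_turn (Q.turn x)
      have e2 := P.turn_ne (Q.turn x)
      have e3 := Q.turn_ne x
      grind
    have hw2 : P.turn (Q.turn z) = Q.turn x := by rw [← hw, P.turn_turn]
    have hne : Q.turn x ≠ Q.turn z := by rw [← hw]; exact (P.turn_ne _).symm
    rw [hz] at h
    ext s
    induction s using Sym2.ind with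
    | _ p q =>
      rw [CircuitPartition.mem_transition_iff, mem_psi_iff, ← hQ]
      refine and_congr_right fun hp => ?_
      constructor
      · rintro rfl
        rcases hfib hp with rfl | rfl | rfl | rfl <;> grind
      · rintro ⟨hq, hpq, hf⟩
        rcases hfib hp with rfl | rfl | rfl | rfl <;>
          rcases hfib hq with rfl | rfl | rfl | rfl <;> grind

end EulerSystem

end HalfEdgeGraph

/-! ### Rank of an integer matrix modulo a prime -/

namespace Matrix

variable {m n : Type*} [Fintype m] [Fintype n] [DecidableEq m] [DecidableEq n]

/-- A matrix of rank `r` can be compressed to the identity matrix of size `r`. -/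
theorem exists_mul_mul_eq_one {K : Type*} [Field K] (M : Matrix m n K) {r : ℕ}
    (hr : M.rank = r) :
    ∃ (A : Matrix (Fin r) m K) (X : Matrix n (Fin r) K), A * M * X = 1 := by
  let f := M.mulVecLin
  let e : (Fin r → K) ≃ₗ[K] LinearMap.range f :=
    (Module.finBasisOfFinrankEq K (LinearMap.range f) hr).equivFun.symm
  obtain ⟨g, hg⟩ := LinearMap.exists_leftInverse_of_injective
    ((LinearMap.range f).subtype ∘ₗ e.toLinearMap)
    (LinearMap.ker_eq_bot.2 ((Submodule.injective_subtype _).comp e.injective))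
  obtain ⟨s, hs⟩ := LinearMap.exists_rightInverse_of_surjective f.rangeRestrict
    (LinearMap.range_rangeRestrict f)
  refine ⟨LinearMap.toMatrix' g, LinearMap.toMatrix' (s ∘ₗ e.toLinearMap), ?_⟩
  have hM : M = LinearMap.toMatrix' f := (LinearMap.toMatrix'_toLin' M).symm
  have key : (g ∘ₗ f) ∘ₗ (s ∘ₗ e.toLinearMap) = LinearMap.id := by
    rw [← hg]
    refine LinearMap.ext fun i => ?_
    have : ∀ y, f (s y) = y := fun y => congrArg Subtype.val (LinearMap.congr_fun hs y)
    exact congrArg g (this _)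
  calc _ = LinearMap.toMatrix' g * LinearMap.toMatrix' f *
        LinearMap.toMatrix' (s ∘ₗ e.toLinearMap) := by rw [← hM]
    _ = 1 := by rw [← LinearMap.toMatrix'_comp, ← LinearMap.toMatrix'_comp, key,
        LinearMap.toMatrix'_id]

/-- Reduction modulo `p` cannot raise the rank of an integer matrix: if `A * M * X` is the identity
matrix modulo `p`, then its determinant is nonzero. -/
theorem rank_map_zmod_le {K : Type*} [Field K] [CharZero K] (p : ℕ) [Fact p.Prime]
    (M : Matrix m n ℤ) :
    (M.map (Int.cast : ℤ → ZMod p)).rank ≤ (M.map (Int.cast : ℤ → K)).rank := by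
  obtain ⟨r, hr⟩ : ∃ r, (M.map (Int.cast : ℤ → ZMod p)).rank = r := ⟨_, rfl⟩
  obtain ⟨A, X, h⟩ := exists_mul_mul_eq_one _ hr
  rw [hr]
  obtain ⟨A', rfl⟩ : ∃ A' : Matrix (Fin r) m ℤ, A'.map (Int.castRingHom (ZMod p)) = A :=
    ⟨A.map fun x => x.cast, by ext; simp⟩
  obtain ⟨X', rfl⟩ : ∃ X' : Matrix n (Fin r) ℤ, X'.map (Int.castRingHom (ZMod p)) = X :=
    ⟨X.map fun x => x.cast, by ext; simp⟩
  change A'.map (Int.castRingHom (ZMod p)) * M.map (Int.castRingHom (ZMod p)) *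
    X'.map (Int.castRingHom (ZMod p)) = 1 at h
  change r ≤ (M.map (Int.castRingHom K)).rank
  rw [← Matrix.map_mul, ← Matrix.map_mul] at h
  have hdet : (A' * M * X').det ≠ 0 := by
    intro h0
    have := congrArg det h
    rw [det_one, ← RingHom.mapMatrix_apply, ← RingHom.map_det, h0, map_zero] at this
    exact zero_ne_one this
  have hunit : IsUnit ((A' * M * X').map (Int.castRingHom K)) := by
    rw [Matrix.isUnit_iff_isUnit_det, ← RingHom.mapMatrix_apply, ← RingHom.map_det]
    simpa using hdet
  have h1 := rank_of_isUnit _ hunit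
  rw [Fintype.card_fin, Matrix.map_mul, Matrix.map_mul] at h1
  rw [← h1]
  exact (rank_mul_le_left _ _).trans (rank_mul_le_right _ _)

end Matrix

/-! ### Walks in directed multigraphs -/

namespace Graph

variable {α β : Type*} {G : Graph α β} (D : G.DirectedVersion)

/-- `W` is a walk from `u` to `w`. -/
def DirectedVersion.IsWalk : α → List (β × Bool) → α → Prop
  | u, [], w => u = w
  | u, s :: W, w => s.1 ∈ G.edgeSet ∧ D.start s = u ∧ DirectedVersion.IsWalk (D.finish s) W w

namespace DirectedVersion

variable {D}

theorem IsWalk.append {u v w : α} {W W' : List (β × Bool)} (h : D.IsWalk u W v)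
    (h' : D.IsWalk v W' w) : D.IsWalk u (W ++ W') w := by
  induction W generalizing u with
  | nil => cases h; exact h'
  | cons s W ih => exact ⟨h.1, h.2.1, ih h.2.2⟩

theorem IsWalk.mem_edgeSet {u w : α} {W : List (β × Bool)} (h : D.IsWalk u W w) :
    ∀ s ∈ W, s.1 ∈ G.edgeSet := by
  induction W generalizing u with
  | nil => simp
  | cons s W ih =>
    simp only [List.mem_cons, forall_eq_or_imp]
    exact ⟨h.1, ih h.2.2⟩

theorem IsWalk.isChain {u w : α} {s t : β × Bool} {W : List (β × Bool)}
    (h : D.IsWalk u (s :: W) w) (ht : D.start t = w) :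
    List.IsChain (fun s t => D.finish s = D.start t) (s :: (W ++ [t])) := by
  induction W generalizing u s with
  | nil =>
    refine List.isChain_cons_cons.2 ⟨?_, List.isChain_singleton _⟩
    rw [ht]
    exact h.2.2
  | cons r W ih => exact List.isChain_cons_cons.2 ⟨h.2.2.2.1.symm, ih h.2.2⟩

theorem IsWalk.isClosedWalk {u : α} {W : List (β × Bool)} (h : D.IsWalk u W u) :
    D.IsClosedWalk W := by
  refine ⟨h.mem_edgeSet, ?_⟩
  cases W with
  | nil => trivial
  | cons s W => exact h.isChain h.2.1

variable (D) in
theorem sum_finish_eq_sum_start {K : Type*} [AddCommMonoid K] (p : α → K) {s t : β × Bool}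
    {W : List (β × Bool)}
    (h : List.IsChain (fun s t => D.finish s = D.start t) (s :: (W ++ [t]))) :
    ((s :: W).map fun r => p (D.finish r)).sum = ((W ++ [t]).map fun r => p (D.start r)).sum := by
  induction W generalizing s with
  | nil =>
    have := (List.isChain_cons_cons.1 h).1
    simp [this]
  | cons r W ih =>
    obtain ⟨h1, h2⟩ := List.isChain_cons_cons.1 h
    rw [List.map_cons, List.sum_cons, ih h2, h1]
    simp

variable {K : Type*} [Field K]

theorem sum_walkVector_mul [Fintype β] [DecidableEq β] (W : List (β × Bool)) (p : α → K) :
    ∑ e, walkVector K W e * (p (D.tgt e) - p (D.src e)) =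
      (W.map fun r => p (D.finish r)).sum - (W.map fun r => p (D.start r)).sum := by
  induction W with
  | nil => simp [walkVector]
  | cons s W ih =>
    have : ∀ e, walkVector K (s :: W) e = walkVector K W e +
        if e = s.1 then (if s.2 then 1 else -1) else 0 := by
      intro e
      obtain ⟨e', t⟩ := s
      simp only [walkVector, List.count_cons]
      by_cases h : e = e'
      · subst h
        cases t <;> simp <;> ring
      · simp [h, Ne.symm h]
    simp only [this, add_mul, Finset.sum_add_distrib, ih, ite_mul, zero_mul, Finset.sum_ite_eq',
      Finset.mem_univ, if_true, List.map_cons, List.sum_cons, start, finish]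
    cases s.2 <;> simp <;> ring

/-- Cycles are orthogonal to coboundaries. -/
theorem sum_mul_eq_zero_of_mem_cycleSpace [Fintype β] [DecidableEq β] {z : β → K}
    (hz : z ∈ D.cycleSpace K) (p : α → K) :
    ∑ e, z e * (p (D.tgt e) - p (D.src e)) = 0 := by
  induction hz using Submodule.span_induction with
  | mem z hz =>
    obtain ⟨W, hW, rfl⟩ := hz
    rw [sum_walkVector_mul]
    cases W with
    | nil => simp
    | cons s W =>
      rw [D.sum_finish_eq_sum_start p hW.2]
      simp [add_comm]
  | zero => simp
  | add x y _ _ hx hy => simp [add_mul, Finset.sum_add_distrib, hx, hy]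
  | smul a x _ hx => simp [mul_assoc, ← Finset.mul_sum, hx]

end DirectedVersion

end Graph

namespace HalfEdgeGraph

variable {V H : Type*} {F : HalfEdgeGraph V H}

/-! ### The coboundary of the touch-graph -/

namespace CircuitPartition

variable {P : F.CircuitPartition}

section

variable [DecidableEq H]

theorem passesThrough_circ (h : H) : (P.circ h).PassesThrough (F.vert h) := by
  by_cases hf : P.Fwd h
  · exact ⟨h, hf, rfl⟩
  · refine ⟨P.turn h, ?_, P.vert_turn h⟩
    rw [← P.fwd_turn] at hf
    rwa [Fwd, circ_turn] at hf

/-- The circuits through a vertex are those of any two half-edges not paired by `P`. -/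
theorem isLink_touchGraph (hF : F.IsFourRegular) {x y : H} (hxy : F.vert y = F.vert x)
    (h1 : y ≠ x) (h2 : y ≠ P.turn x) :
    P.touchGraph.IsLink (F.vert x) (P.circ x) (P.circ y) := by
  intro δ
  constructor
  · rintro ⟨hδ, z, hz, hzx⟩
    have e : P.circ z = δ := circ_eq hδ (Or.inl hz)
    rw [← e]
    rcases P.fiber_subset hF hxy h1 h2 hzx with rfl | rfl | rfl | rfl <;> simp [P.circ_turn]
  · rintro (rfl | rfl)
    · exact ⟨P.circ_mem _, passesThrough_circ x⟩
    · exact ⟨P.circ_mem _, hxy ▸ passesThrough_circ y⟩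

theorem mem_edgeSet_touchGraph (hF : F.IsFourRegular) (v : V) : v ∈ P.touchGraph.edgeSet := by
  obtain ⟨x, rfl⟩ := hF.exists_vert_eq v
  obtain ⟨y, h0, h1, h2⟩ := P.exists_other hF x
  exact (isLink_touchGraph hF h0 h1 h2).edge_mem

theorem ends_eq (hF : F.IsFourRegular) (D : P.touchGraph.DirectedVersion) {x y : H}
    (hxy : F.vert y = F.vert x) (h1 : y ≠ x) (h2 : y ≠ P.turn x) :
    D.src (F.vert x) = P.circ x ∧ D.tgt (F.vert x) = P.circ y ∨
      D.src (F.vert x) = P.circ y ∧ D.tgt (F.vert x) = P.circ x :=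
  (D.isLink _ (mem_edgeSet_touchGraph hF _)).eq_and_eq_or_eq_and_eq
    (isLink_touchGraph hF hxy h1 h2)

theorem circ_eq_src_or_tgt (hF : F.IsFourRegular) (D : P.touchGraph.DirectedVersion) (x : H) :
    P.circ x = D.src (F.vert x) ∨ P.circ x = D.tgt (F.vert x) := by
  obtain ⟨y, h0, h1, h2⟩ := P.exists_other hF x
  rcases ends_eq hF D h0 h1 h2 with h | h
  · exact Or.inl h.1.symm
  · exact Or.inr h.2.symm

theorem src_mem (hF : F.IsFourRegular) (D : P.touchGraph.DirectedVersion) (v : V) :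
    D.src v ∈ P.circuits :=
  (D.isLink _ (mem_edgeSet_touchGraph hF v)).left_mem

theorem tgt_mem (hF : F.IsFourRegular) (D : P.touchGraph.DirectedVersion) (v : V) :
    D.tgt v ∈ P.circuits :=
  (D.isLink _ (mem_edgeSet_touchGraph hF v)).right_mem

end

open Classical in
/-- The coboundary matrix of the touch-graph: `coboundary K D *ᵥ p` maps the vertex `v` of `F` to
the difference of the values of `p` at the end and at the beginning of the directed edge `e_v`. -/
noncomputable def coboundary (K : Type*) [Field K] (D : P.touchGraph.DirectedVersion) :
    Matrix V P.circuits K :=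
  fun v γ => (if D.tgt v = γ then 1 else 0) - (if D.src v = γ then 1 else 0)

variable {K : Type*} [Field K]

theorem coboundary_mulVec [DecidableEq H] (hF : F.IsFourRegular)
    (D : P.touchGraph.DirectedVersion) (p : P.circuits → K) (v : V) :
    (coboundary K D).mulVec p v =
      p ⟨D.tgt v, tgt_mem hF D v⟩ - p ⟨D.src v, src_mem hF D v⟩ := by
  classical
  have e : ∀ (a : F.Circuit) (ha : a ∈ P.circuits) (γ : P.circuits),
      a = γ ↔ (⟨a, ha⟩ : P.circuits) = γ := fun a ha γ => by rw [Subtype.ext_iff]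
  simp only [Matrix.mulVec, dotProduct, coboundary, sub_mul, ite_mul, one_mul, zero_mul,
    Finset.sum_sub_distrib, e _ (tgt_mem hF D v), e _ (src_mem hF D v), Finset.sum_ite_eq,
    Finset.mem_univ, if_true]

/-- The functions on the circuits of `P` that take equal values at the ends of every edge of the
touch-graph correspond to the functions on the set of components of `F`. -/
theorem rank_coboundary_add_numComponents [Fintype V] [DecidableEq H] (hF : F.IsFourRegular)
    (D : P.touchGraph.DirectedVersion) :
    (coboundary K D).rank + F.numComponents = P.circuits.card := by
  classical
  have : Finite F.Component := inferInstanceAs (Finite (Quot F.Adj))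
  have := Fintype.ofFinite F.Component
  choose s hs using fun γ : P.circuits => P.exists_circ_eq γ.2
  -- pull back functions along the map that sends a circuit to its component
  let Φ : (F.Component → K) →ₗ[K] (P.circuits → K) :=
    LinearMap.funLeft K K fun γ => F.component (F.vert (s γ))
  have hΦ : ∀ q h, Φ q ⟨P.circ h, P.circ_mem h⟩ = q (F.component (F.vert h)) := fun q h =>
    congrArg q (P.component_eq_of_circ_eq (hs _))
  have hinj : Function.Injective Φ := by
    intro q q' h
    funext k
    induction k using Quot.ind with
    | _ v =>
      obtain ⟨x, rfl⟩ := hF.exists_vert_eq v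
      have := congrFun h ⟨P.circ x, P.circ_mem x⟩
      rwa [hΦ, hΦ] at this
  have hrange : LinearMap.range Φ = LinearMap.ker (coboundary K D).mulVecLin := by
    ext p
    rw [LinearMap.mem_ker, Matrix.mulVecLin_apply]
    constructor
    · rintro ⟨q, rfl⟩
      funext v
      obtain ⟨x, rfl⟩ := hF.exists_vert_eq v
      obtain ⟨y, h0, h1, h2⟩ := P.exists_other hF x
      rw [coboundary_mulVec hF]
      rcases ends_eq hF D h0 h1 h2 with h | h <;> simp only [h.1, h.2, hΦ, h0] <;> simp
    · intro hp
      have hp' : ∀ v, p ⟨D.tgt v, tgt_mem hF D v⟩ = p ⟨D.src v, src_mem hF D v⟩ := fun v =>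
        sub_eq_zero.1 ((coboundary_mulVec hF D p v).symm.trans (congrFun hp v))
      have hx : ∀ x, p ⟨P.circ x, P.circ_mem x⟩ =
          p ⟨D.src (F.vert x), src_mem hF D (F.vert x)⟩ := by
        intro x
        rcases circ_eq_src_or_tgt hF D x with h | h
        · simp only [h]
        · simp only [h, hp']
      refine ⟨Quot.lift (fun v => p ⟨D.src v, src_mem hF D v⟩) ?_, ?_⟩
      · rintro _ _ ⟨h, rfl, rfl⟩
        rw [← hx, ← hx]
        simp only [P.circ_opp]
      · funext γ
        obtain ⟨γ, hγ⟩ := γ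
        obtain ⟨x, rfl⟩ := P.exists_circ_eq hγ
        exact (hΦ _ x).trans (hx x).symm
  have h1 := LinearMap.finrank_range_add_finrank_ker (coboundary K D).mulVecLin
  rw [← hrange, LinearMap.finrank_range_of_inj hinj] at h1
  simpa [Matrix.rank, numComponents, Nat.card_eq_fintype_card] using h1

theorem finrank_cycleSpace_add_rank_coboundary_le [Fintype V] [DecidableEq V]
    (D : P.touchGraph.DirectedVersion) :
    Module.finrank K (D.cycleSpace K) + (coboundary K D).rank ≤ Fintype.card V := by
  classical
  have hle : D.cycleSpace K ≤ LinearMap.ker (coboundary K D).transpose.mulVecLin := by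
    intro z hz
    rw [LinearMap.mem_ker, Matrix.mulVecLin_apply]
    funext γ
    have := Graph.DirectedVersion.sum_mul_eq_zero_of_mem_cycleSpace hz
      (fun δ => if δ = (γ : F.Circuit) then (1 : K) else 0)
    rw [Pi.zero_apply, ← this]
    simp only [Matrix.mulVec, dotProduct, Matrix.transpose_apply, coboundary, mul_comm]
  have h1 := LinearMap.finrank_range_add_finrank_ker (coboundary K D).transpose.mulVecLin
  have h2 := Submodule.finrank_mono hle
  have h3 : Module.finrank K (LinearMap.range (coboundary K D).transpose.mulVecLin) =
    (coboundary K D).rank := Matrix.rank_transpose _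
  rw [Module.finrank_fintype_fun_eq_card] at h1
  omega

end CircuitPartition

end HalfEdgeGraph

/-! ### Alternating occurrences in a cyclic sequence -/

namespace List

variable {α : Type*}

theorem IsRotated.filter {l l' : List α} (h : l ~r l') (p : α → Bool) :
    l.filter p ~r l'.filter p := by
  obtain ⟨n, hn, rfl⟩ := List.isRotated_iff_mod.1 h
  rw [List.rotate_eq_drop_append_take hn, List.filter_append]
  conv_lhs => rw [← List.take_append_drop n l, List.filter_append]
  exact List.isRotated_append

variable [DecidableEq α]

theorem filter_eq_or_eq_of_notMem {v w : α} {l : List α} (h : v ∉ l) :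
    l.filter (fun x => decide (x = v ∨ x = w)) = replicate (l.count w) w := by
  rw [← List.filter_eq]
  refine List.filter_congr fun x hx => ?_
  have : x ≠ v := fun e => h (e ▸ hx)
  simp [this]

/-- If `v` occurs twice in a cyclic sequence and `w` occurs twice or not at all, then they
alternate if and only if `w` occurs once between the occurrences of `v`. -/
theorem exists_alternating_iff {v w : α} (hvw : v ≠ w) {A B E : List α} (hA : v ∉ A) (hB : v ∉ B)
    (hE : v ∉ E)
    (hc : (A ++ v :: (B ++ v :: E)).count w = 0 ∨ (A ++ v :: (B ++ v :: E)).count w = 2) :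
    (∃ l, l ~r A ++ v :: (B ++ v :: E) ∧ ([v, w, v, w] <+ l ∨ [w, v, w, v] <+ l)) ↔
      B.count w = 1 := by
  set L := A ++ v :: (B ++ v :: E) with hL
  -- only the occurrences of `v` and `w` matter
  let p : α → Bool := fun x => decide (x = v ∨ x = w)
  have hf : L.filter p = replicate (A.count w) w ++ v ::
      (replicate (B.count w) w ++ v :: replicate (E.count w) w) := by
    rw [hL, List.filter_append, List.filter_cons_of_pos (by simp [p]), List.filter_append,
      List.filter_cons_of_pos (by simp [p])]
    simp only [p, filter_eq_or_eq_of_notMem, hA, hB, hE, not_false_eq_true]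
  have hcount : L.count w = A.count w + (B.count w + E.count w) := by
    simp [hL, List.count_append, hvw]
  rw [hcount] at hc
  generalize A.count w = i at hf hc
  generalize B.count w = j at hf hc ⊢
  generalize E.count w = k at hf hc
  have hlen : (L.filter p).length = i + j + k + 2 := by
    rw [hf]
    simp
    omega
  constructor
  · rintro ⟨l, hl, h⟩
    have hrot := hl.filter p
    have hlen' := hrot.perm.length_eq
    have hl4 : (l.filter p).length ≤ 4 := by omega
    have h' : l.filter p = [v, w, v, w] ∨ l.filter p = [w, v, w, v] := by
      rcases h with h | h
      · have h2 := h.filter p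
        simp only [p, List.filter_cons, decide_true, true_or, or_true, if_true,
          List.filter_nil] at h2
        exact Or.inl (h2.eq_of_length_le hl4).symm
      · have h2 := h.filter p
        simp only [p, List.filter_cons, decide_true, true_or, or_true, if_true,
          List.filter_nil] at h2
        exact Or.inr (h2.eq_of_length_le hl4).symm
    have h4 : (l.filter p).length = 4 := by rcases h' with h' | h' <;> rw [h'] <;> rfl
    have hL' : L.filter p = [v, w, v, w] ∨ L.filter p = [w, v, w, v] := by
      obtain ⟨n, hn, e⟩ := List.isRotated_iff_mod.1 hrot
      rw [h4] at hn
      rw [← e]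
      rcases h' with h' | h' <;> rw [h'] <;> interval_cases n <;> simp
    rw [hf] at hL'
    have hijk : i + j + k = 2 := by omega
    have hi : i ≤ 2 := by omega
    have hj : j ≤ 2 := by omega
    have hk : k = 2 - i - j := by omega
    subst hk
    interval_cases i <;> interval_cases j <;>
      simp_all [hvw.symm, List.replicate_succ]
  · rintro rfl
    refine ⟨L, List.IsRotated.refl _, ?_⟩
    have : (i = 0 ∧ k = 1) ∨ (i = 1 ∧ k = 0) := by omega
    rcases this with ⟨rfl, rfl⟩ | ⟨rfl, rfl⟩
    · left
      have := hf ▸ (List.filter_sublist (p := p) (l := L))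
      simpa using this
    · right
      have := hf ▸ (List.filter_sublist (p := p) (l := L))
      simpa using this

theorem sum_map_eq_sum_count_mul {R : Type*} [CommSemiring R] [Fintype α] (g : α → R)
    (l : List α) : (l.map g).sum = ∑ w, (l.count w : R) * g w := by
  rw [Finset.sum_list_map_count]
  simp only [nsmul_eq_mul]
  refine Finset.sum_subset (Finset.subset_univ _) fun x _ hx => ?_
  rw [List.mem_toFinset] at hx
  simp [List.count_eq_zero_of_not_mem hx]

end List

namespace HalfEdgeGraph

variable {V H : Type*} {F : HalfEdgeGraph V H}

/-! ### Splitting an Euler circuit at a vertex -/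

namespace EulerSystem

variable {C : F.EulerSystem}

theorem mem_iff_of_steps_eq [Finite V] {K : F.Component} {l : List H}
    (hl : (C.circuit K).steps = l) {h : H} :
    h ∈ l ↔ F.component (F.vert h) = K ∧ C.toCircuitPartition.Fwd h := by
  rw [← Cycle.mem_coe_iff, ← hl, CircuitPartition.Fwd, circ_toCircuitPartition]
  constructor
  · intro h1
    have := (C.isEulerCircuit K h).1 (Or.inl h1)
    exact ⟨this, this ▸ h1⟩
  · rintro ⟨rfl, h1⟩
    exact h1

theorem nodup_of_steps_eq {K : F.Component} {l : List H} (hl : (C.circuit K).steps = l) :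
    l.Nodup := by
  rw [← Cycle.nodup_coe_iff, ← hl]
  exact (C.circuit K).nodup

end EulerSystem

/-- The half-edges at every vertex that `P` directs away from it are two in number. -/
theorem CircuitPartition.exists_fwd_pair [DecidableEq H] (P : F.CircuitPartition)
    (hF : F.IsFourRegular) (v : V) :
    ∃ b b', F.vert b = v ∧ F.vert b' = v ∧ P.Fwd b ∧ P.Fwd b' ∧ b ≠ b' ∧
      ∀ z, F.vert z = v → P.Fwd z → z = b ∨ z = b' := by
  have hex : ∀ x, ∃ z, F.vert z = F.vert x ∧ P.Fwd z ∧ (z = x ∨ z = P.turn x) := by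
    intro x
    by_cases h : P.Fwd x
    · exact ⟨x, rfl, h, Or.inl rfl⟩
    · exact ⟨_, P.vert_turn x, P.fwd_turn.2 h, Or.inr rfl⟩
  obtain ⟨x, hx⟩ := hF.exists_vert_eq v
  obtain ⟨b, hb, hbf, -⟩ := hex x
  obtain ⟨y, h0, h1, h2⟩ := P.exists_other hF b
  obtain ⟨b', hb', hbf', h⟩ := hex y
  have e := P.turn_turn y
  have e' := P.turn_turn b
  have f1 := P.fwd_turn (h := b)
  have f2 := P.fwd_turn (h := b')
  refine ⟨b, b', hb.trans hx, by rw [hb', h0, hb, hx], hbf, hbf', by grind, ?_⟩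
  intro z hz hzf
  have := P.fiber_subset hF h0 h1 h2 (z := z) (by rw [hz, hb, hx])
  grind

namespace EulerSystem

variable {C : F.EulerSystem}

/-- The Euler circuit through `v`, written as a list, is divided by the two passages through `v`.
The half-edges `b` and `b'` are those along which it leaves `v`. -/
theorem exists_split [Finite V] [DecidableEq H] (hF : F.IsFourRegular) (v : V) {l : List H}
    (hl : (C.circuit (F.component v)).steps = l) :
    ∃ A b B b' E, l = A ++ b :: (B ++ b' :: E) ∧ F.vert b = v ∧ F.vert b' = v ∧
      v ∉ A.map F.vert ∧ v ∉ B.map F.vert ∧ v ∉ E.map F.vert := by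
  have key : ∀ b b', F.vert b = v → F.vert b' = v →
      (∀ z, F.vert z = v → C.toCircuitPartition.Fwd z → z = b ∨ z = b') →
      ∀ A B E, l = A ++ b :: (B ++ b' :: E) →
      v ∉ A.map F.vert ∧ v ∉ B.map F.vert ∧ v ∉ E.map F.vert := by
    intro b b' hb hb' hz A B E e
    have hn := nodup_of_steps_eq hl
    have hmem := fun h => (mem_iff_of_steps_eq hl (h := h)).1
    rw [e] at hn hmem
    simp only [List.mem_map, not_exists, not_and]
    simp only [List.nodup_append, List.nodup_cons, List.mem_append, List.mem_cons] at hn hmem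
    refine ⟨fun z h1 h2 => ?_, fun z h1 h2 => ?_, fun z h1 h2 => ?_⟩ <;>
      rcases hz z h2 (hmem z (by tauto)).2 with rfl | rfl <;> grind
  obtain ⟨b, b', hb, hb', hbf, hbf', hne, hz⟩ := C.toCircuitPartition.exists_fwd_pair hF v
  have h1 : b ∈ l := (mem_iff_of_steps_eq hl).2 ⟨by rw [hb], hbf⟩
  have h2 : b' ∈ l := (mem_iff_of_steps_eq hl).2 ⟨by rw [hb'], hbf'⟩
  obtain ⟨A, R, rfl⟩ := List.append_of_mem h1
  rw [List.mem_append, List.mem_cons] at h2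
  rcases h2 with h2 | h2 | h2
  · obtain ⟨X, Y, rfl⟩ := List.append_of_mem h2
    have e : X ++ b' :: Y ++ b :: R = X ++ b' :: (Y ++ b :: R) := by simp
    exact ⟨X, b', Y, b, R, e, hb', hb,
      key b' b hb' hb (fun z h h' => (hz z h h').symm) X Y R e⟩
  · exact (hne h2.symm).elim
  · obtain ⟨X, Y, rfl⟩ := List.append_of_mem h2
    exact ⟨A, b, X, b', Y, rfl, hb, hb', key b b' hb hb' hz A X Y rfl⟩

/-- An Euler circuit visits each vertex of its component twice. -/
theorem count_vertices [Finite V] [DecidableEq V] [DecidableEq H] (hF : F.IsFourRegular)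
    {K : F.Component} {l : List H} (hl : (C.circuit K).steps = l) (w : V) :
    (l.map F.vert).count w = 0 ∨ (l.map F.vert).count w = 2 := by
  by_cases h : w ∈ l.map F.vert
  · right
    obtain ⟨x, hx, rfl⟩ := List.mem_map.1 h
    obtain rfl := ((mem_iff_of_steps_eq hl).1 hx).1
    obtain ⟨A, b, B, b', E, rfl, hb, hb', hA, hB, hE⟩ := exists_split hF _ hl
    simp [List.count_append, hb, hb', List.count_eq_zero_of_not_mem hA,
      List.count_eq_zero_of_not_mem hB, List.count_eq_zero_of_not_mem hE]
  · left
    exact List.count_eq_zero_of_not_mem h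

theorem interlaced_iff [Finite V] [DecidableEq V] [DecidableEq H] (hF : F.IsFourRegular)
    {v w : V} (hvw : v ≠ w) {A B E : List H} {b b' : H}
    (hl : (C.circuit (F.component v)).steps = ((A ++ b :: (B ++ b' :: E) : List H) : Cycle H))
    (hb : F.vert b = v) (hb' : F.vert b' = v) (hA : v ∉ A.map F.vert) (hB : v ∉ B.map F.vert)
    (hE : v ∉ E.map F.vert) : C.Interlaced v w ↔ (B.map F.vert).count w = 1 := by
  have hc := count_vertices hF hl w
  have hmap : (A ++ b :: (B ++ b' :: E)).map F.vert =
    A.map F.vert ++ v :: (B.map F.vert ++ v :: E.map F.vert) := by simp [hb, hb']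
  rw [hmap] at hc
  rw [← List.exists_alternating_iff hvw hA hB hE hc]
  constructor
  · rintro ⟨-, K, l, hK, h⟩
    refine ⟨l, ?_, h⟩
    have hv : v ∈ (C.circuit K).vertices := by
      rw [← hK, Cycle.mem_coe_iff]
      rcases h with h | h <;> exact h.subset (by simp)
    obtain ⟨x, hx, rfl⟩ := Cycle.mem_map.1 hv
    obtain rfl := (C.isEulerCircuit K x).1 (Or.inl hx)
    rw [Circuit.vertices, hl, Cycle.map_coe, hmap, Cycle.coe_eq_coe] at hK
    exact hK
  · rintro ⟨l, hl', h⟩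
    refine ⟨hvw, F.component v, l, ?_, h⟩
    rw [Circuit.vertices, hl, Cycle.map_coe, hmap, Cycle.coe_eq_coe]
    exact hl'

variable [DecidableEq H]

theorem turn_opp_eq_next [Finite V] {K : F.Component} {x : H} (hx : x ∈ (C.circuit K).steps) :
    C.toCircuitPartition.turn (F.opp x) = (C.circuit K).steps.next (C.circuit K).nodup x hx := by
  have : C.toCircuitPartition.circ x = C.circuit K :=
    CircuitPartition.circ_eq (C.mem_toCircuitPartition.2 ⟨K, rfl⟩) (Or.inl hx)
  rw [CircuitPartition.turn, CircuitPartition.circ_opp, this, Circuit.turn_opp hx]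

theorem chain_turn [Finite V] (K : F.Component) :
    (C.circuit K).steps.Chain fun x y => C.toCircuitPartition.turn (F.opp x) = y :=
  ((C.circuit K).steps.chain_next (C.circuit K).nodup).imp
    fun _ _ ⟨hx, h⟩ => (turn_opp_eq_next hx).trans h

theorem isChain_turn [Finite V] {K : F.Component} {l : List H} (hl : (C.circuit K).steps = l) :
    l.IsChain fun x y => C.toCircuitPartition.turn (F.opp x) = y := by
  have := C.chain_turn K
  rw [hl] at this
  cases l with
  | nil => exact List.isChain_nil
  | cons a l =>
    rw [Cycle.chain_coe_cons, ← List.cons_append] at this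
    exact this.left_of_append

/-- Row `v` of the modified interlacement matrix, read off the part `B` of the Euler circuit
between its two departures `b`, `b'` from `v`. Note that `turn b'` is the half-edge along which
the circuit arrives at `v` after `B`. -/
theorem modifiedInterlacementMatrix_apply [Finite V] [DecidableEq V] (hF : F.IsFourRegular)
    (P : F.CircuitPartition) {v : V} {A B E : List H} {b b' : H}
    (hl : (C.circuit (F.component v)).steps = ((A ++ b :: (B ++ b' :: E) : List H) : Cycle H))
    (hb : F.vert b = v) (hb' : F.vert b' = v) (hA : v ∉ A.map F.vert) (hB : v ∉ B.map F.vert)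
    (hE : v ∉ E.map F.vert) (w : V) [Decidable (P.transition w = C.phi w)] :
    C.modifiedInterlacementMatrix P v w =
      (if P.transition w = C.phi w then 0 else ((B.map F.vert).count w : ZMod 2)) +
        if w = v ∧ b ≠ P.turn (C.toCircuitPartition.turn b') then 1 else 0 := by
  have hn := nodup_of_steps_eq hl
  have hbf := ((mem_iff_of_steps_eq hl (h := b)).1 (by simp)).2
  have hbf' := ((mem_iff_of_steps_eq hl (h := b')).1 (by simp)).2
  have hne : b ≠ b' := by
    rintro rfl
    simp [List.nodup_append] at hn
  by_cases hvw : v = w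
  · subst hvw
    set Q := C.toCircuitPartition with hQ
    have h0 : (B.map F.vert).count v = 0 := List.count_eq_zero_of_not_mem hB
    have hnI : ¬ C.Interlaced v v := fun h => h.1 rfl
    have hva : F.vert (Q.turn b') = v := by rw [Q.vert_turn, hb']
    have hfa : ¬ Q.Fwd (Q.turn b') := by rw [Q.fwd_turn]; tauto
    have hphi := C.transition_eq_phi_iff hF P (x := Q.turn b')
    have hpsi := C.transition_eq_psi_iff hF P (x := Q.turn b')
    rw [hva, ← hQ, Q.turn_turn] at hphi
    rw [hva, ← hQ] at hpsi
    have hiff : (P.transition v = C.phi v ∨ P.transition v = C.psi v) ↔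
        b ≠ P.turn (Q.turn b') := by
      rw [hphi, hpsi]
      have := Q.fiber_subset hF (x := b) (y := b') (z := P.turn (Q.turn b')) (by rw [hb, hb'])
        hne.symm (by rintro rfl; rw [Q.fwd_turn] at hbf'; tauto)
        (by rw [P.vert_turn, hva, hb])
      have e1 := P.turn_ne (Q.turn b')
      have e2 := Q.fwd_turn (h := b)
      grind
    simp only [modifiedInterlacementMatrix, interlacementMatrix, hnI, h0, ← hiff, true_and,
      and_true, if_true, if_false, Nat.cast_zero, ite_self, zero_add]
    split_ifs <;> tauto
  · simp only [modifiedInterlacementMatrix, interlacementMatrix,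
      interlaced_iff hF hvw hl hb hb' hA hB hE, hvw, Ne.symm hvw, and_false, false_and, if_false,
      add_zero]
    have hc := count_vertices hF hl w
    have hle : (B.map F.vert).count w ≤ ((A ++ b :: (B ++ b' :: E)).map F.vert).count w := by
      refine List.Sublist.count_le _ (List.Sublist.map _ ?_)
      exact ((List.sublist_append_left B _).cons _).trans (List.sublist_append_right A _)
    have h2 : (B.map F.vert).count w ≤ 2 := by omega
    congr 1
    interval_cases (B.map F.vert).count w
    · simp
    · simp
    · simp
      rfl

end EulerSystem

end HalfEdgeGraph

namespace HalfEdgeGraph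

variable {V H : Type*} {F : HalfEdgeGraph V H} [DecidableEq H]

/-! ### Closed walks in the touch-graph from closed trails in `F` -/

namespace CircuitPartition

variable {P : F.CircuitPartition}

open Classical in
/-- The walk in the touch-graph, of length at most one, from the circuit through `a` to the circuit
through `b`, where `a` and `b` are half-edges at the same vertex. It is empty when `a` and `b` are
equal or paired by `P`. -/
noncomputable def step (D : P.touchGraph.DirectedVersion) (a b : H) : List (V × Bool) :=
  if b = a ∨ b = P.turn a then [] else [(F.vert a, decide (D.src (F.vert a) = P.circ a))]

theorem isWalk_step (hF : F.IsFourRegular) (D : P.touchGraph.DirectedVersion) {a b : H}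
    (hab : F.vert b = F.vert a) : D.IsWalk (P.circ a) (step D a b) (P.circ b) := by
  rw [step]
  split_ifs with h
  · rcases h with rfl | rfl
    · rfl
    · exact (P.circ_turn a).symm
  · rw [not_or] at h
    have hends := ends_eq hF D hab h.1 h.2
    refine ⟨mem_edgeSet_touchGraph hF _, ?_, ?_⟩ <;>
      simp only [Graph.DirectedVersion.start, Graph.DirectedVersion.finish,
        Graph.DirectedVersion.IsWalk, decide_eq_true_eq] <;> grind

/-- The walk in the touch-graph that accompanies a trail of `F`: it visits the circuits of `P` that
traverse the successive edges of the trail. -/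
noncomputable def trailWalk (D : P.touchGraph.DirectedVersion) : H → List H → List (V × Bool)
  | _, [] => []
  | x, y :: l => step D (F.opp x) y ++ trailWalk D y l

theorem isWalk_trailWalk (hF : F.IsFourRegular) (D : P.touchGraph.DirectedVersion) {x y : H}
    {l : List H} (h : List.IsChain (fun x y => F.vert (F.opp x) = F.vert y) (x :: (l ++ [y]))) :
    D.IsWalk (P.circ x) (trailWalk D x (l ++ [y])) (P.circ y) := by
  induction l generalizing x with
  | nil =>
    have h1 := (List.isChain_cons_cons.1 h).1
    rw [← P.circ_opp x]
    exact (isWalk_step hF D h1.symm).append rfl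
  | cons z l ih =>
    obtain ⟨h1, h2⟩ := List.isChain_cons_cons.1 h
    rw [← P.circ_opp x]
    exact (isWalk_step hF D h1.symm).append (ih h2)

theorem count_step [DecidableEq V] (D : P.touchGraph.DirectedVersion) (a b : H) (w : V) :
    ((step D a b).map Prod.fst).count w =
      if w = F.vert a ∧ b ≠ a ∧ b ≠ P.turn a then 1 else 0 := by
  rw [step]
  by_cases h : b = a ∨ b = P.turn a
  · rw [if_pos h, if_neg (by tauto)]
    rfl
  · rw [if_neg h]
    rw [not_or] at h
    by_cases hw : w = F.vert a
    · simp [h.1, h.2, hw]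
    · simp [hw, Ne.symm hw]

open Classical in
/-- Along a trail that follows the Euler system, the walk in the touch-graph uses the edge `e_w` at
each visit of `w` at which `P` does not follow the Euler system; the last step is treated
separately, since the trail may depart from the Euler system there. -/
theorem count_trailWalk [Finite V] [DecidableEq V] (hF : F.IsFourRegular) (C : F.EulerSystem)
    (D : P.touchGraph.DirectedVersion) {x y y' : H} {l : List H}
    (h : List.IsChain (fun x y => C.toCircuitPartition.turn (F.opp x) = y) (x :: (l ++ [y'])))
    (w : V) :
    ((trailWalk D x (l ++ [y])).map Prod.fst).count w =
      (if P.transition w = C.phi w then 0 else (l.map F.vert).count w) +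
        ((step D (C.toCircuitPartition.turn y') y).map Prod.fst).count w := by
  set Q := C.toCircuitPartition with hQ
  induction l generalizing x with
  | nil =>
    have h1 := (List.isChain_cons_cons.1 h).1
    rw [← h1, Q.turn_turn]
    simp [trailWalk]
  | cons z l ih =>
    obtain ⟨h1, h2⟩ := List.isChain_cons_cons.1 h
    have h3 : F.opp x = Q.turn z := by rw [← h1, Q.turn_turn]
    rw [List.cons_append, trailWalk, List.map_append, List.count_append, ih h2, count_step, h3,
      Q.vert_turn, List.map_cons, List.count_cons, ← add_assoc]
    congr 1
    by_cases hw : w = F.vert z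
    · subst hw
      have hphi := C.transition_eq_phi_iff hF P (x := z)
      have e1 := Q.turn_ne z
      have e2 : z = P.turn (Q.turn z) ↔ P.turn z = Q.turn z :=
        ⟨fun e => by conv_lhs => rw [e, P.turn_turn], fun e => by rw [← e, P.turn_turn]⟩
      simp only [hphi, ← hQ, ne_eq, e2, e1.symm, not_false_eq_true, true_and, beq_self_eq_true,
        if_true]
      split_ifs <;> omega
    · simp [hw, Ne.symm hw]

end CircuitPartition

/-- The vector of a walk reduces modulo `2` to the vector of the numbers of uses of the edges. -/
theorem count_true_sub_count_false_mod_two [DecidableEq V] (W : List (V × Bool)) (w : V) :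
    (((W.count (w, true) : ℤ) - (W.count (w, false) : ℤ) : ℤ) : ZMod 2) =
      (((W.map Prod.fst).count w : ℕ) : ZMod 2) := by
  have : (W.map Prod.fst).count w = W.count (w, true) + W.count (w, false) := by
    induction W with
    | nil => rfl
    | cons s W ih =>
      obtain ⟨u, t⟩ := s
      simp only [List.map_cons, List.count_cons, ih]
      by_cases h : u = w
      · subst h
        cases t <;> simp <;> omega
      · simp [h]
  rw [this]
  push_cast
  rw [CharTwo.sub_eq_add]

/-- Each row of the modified interlacement matrix lifts to the vector of a closed walk in the
touch-graph, which accompanies one of the two closed trails into which the Euler circuit is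
divided by its passages through the vertex. -/
theorem exists_closedWalk [Finite V] [DecidableEq V] (hF : F.IsFourRegular) (C : F.EulerSystem)
    (P : F.CircuitPartition) (D : P.touchGraph.DirectedVersion) (v : V) :
    ∃ W, D.IsClosedWalk W ∧ ∀ w,
      (((W.count (w, true) : ℤ) - (W.count (w, false) : ℤ) : ℤ) : ZMod 2) =
        C.modifiedInterlacementMatrix P v w := by
  classical
  obtain ⟨l, hl⟩ : ∃ l : List H, (C.circuit (F.component v)).steps = l :=
    ⟨_, (Quotient.out_eq _).symm⟩
  obtain ⟨A, b, B, b', E, rfl, hb, hb', hA, hB, hE⟩ := EulerSystem.exists_split hF v hl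
  set Q := C.toCircuitPartition with hQ
  have hchain : List.IsChain (fun x y => Q.turn (F.opp x) = y) (b :: (B ++ [b'])) :=
    (EulerSystem.isChain_turn hl).infix ⟨A, E, by simp⟩
  have hchain' : List.IsChain (fun x y => F.vert (F.opp x) = F.vert y) (b :: (B ++ [b])) := by
    have h1 := hchain.imp (S := fun x y => F.vert (F.opp x) = F.vert y)
      fun x y h => by rw [← h, Q.vert_turn]
    -- replace the final `b'` by `b`, which is at the same vertex
    rw [← List.cons_append, List.isChain_append] at h1 ⊢
    refine ⟨h1.1, List.isChain_singleton _, fun x hx y hy => ?_⟩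
    obtain rfl : b = y := by simpa using hy
    rw [h1.2.2 x hx b' (by simp), hb, hb']
  refine ⟨_, (CircuitPartition.isWalk_trailWalk hF D hchain').isClosedWalk, fun w => ?_⟩
  rw [count_true_sub_count_false_mod_two, CircuitPartition.count_trailWalk hF C D hchain,
    EulerSystem.modifiedInterlacementMatrix_apply hF P hl hb hb' hA hB hE, ← hQ,
    CircuitPartition.count_step, Q.vert_turn, hb']
  have hne : b ≠ Q.turn b' := by
    rintro rfl
    have h1 := ((EulerSystem.mem_iff_of_steps_eq hl (h := Q.turn b')).1 (by simp)).2
    have h2 := ((EulerSystem.mem_iff_of_steps_eq hl (h := b')).1 (by simp)).2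
    rw [← hQ] at h1 h2
    rw [Q.fwd_turn] at h1
    exact h1 h2
  simp only [hne, ne_eq, not_false_eq_true, true_and]
  push_cast
  rfl

/-! ### The kernel of the modified interlacement matrix over `GF(2)` -/

/-- A function `g` on the vertices has a potential `f` along the Euler circuits: when an Euler
circuit passes through a vertex `v`, the value of `f` changes by `g v`. It exists because every
vertex is visited twice. -/
theorem EulerSystem.exists_potential [Fintype V] [DecidableEq V] (hF : F.IsFourRegular)
    (C : F.EulerSystem) (g : V → ZMod 2) : ∃ f : H → ZMod 2, (∀ h, f (F.opp h) = f h) ∧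
      (∀ h, f (C.toCircuitPartition.turn h) = f h + g (F.vert h)) ∧
      ∀ (v : V), ∃ A b B b' E,
        (C.circuit (F.component v)).steps = ((A ++ b :: (B ++ b' :: E) : List H) : Cycle H) ∧
        F.vert b = v ∧ F.vert b' = v ∧
        v ∉ A.map F.vert ∧ v ∉ B.map F.vert ∧ v ∉ E.map F.vert ∧
        f b' = f b + ((B.map F.vert).map g).sum + g v := by
  classical
  set Q := C.toCircuitPartition with hQ
  have hl : ∀ K, ∃ l : List H, (C.circuit K).steps = l := fun K =>
    ⟨_, (Quotient.out_eq _).symm⟩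
  choose l hl using hl
  -- the partial sums of `g` along the list `l K`
  let S : H → ZMod 2 := fun x =>
    (((l (F.component (F.vert x))).take ((l (F.component (F.vert x))).idxOf x + 1)).map
      fun y => g (F.vert y)).sum
  have hS : ∀ {K A x R}, l K = A ++ x :: R →
      S x = (A.map fun y => g (F.vert y)).sum + g (F.vert x) := by
    intro K A x R e
    have hx : x ∈ l K := by simp [e]
    have hK := ((mem_iff_of_steps_eq (hl K)).1 hx).1
    have hn := nodup_of_steps_eq (hl K)
    have hxA : x ∉ A := by
      rw [e, List.nodup_append] at hn
      intro h
      exact hn.2.2 x h x (by simp) rfl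
    have : (A ++ x :: R).idxOf x = A.length := by
      rw [List.idxOf_append_of_notMem hxA, List.idxOf_cons_self, add_zero]
    simp only [S, hK, e, this]
    rw [List.take_append, List.take_of_length_le (Nat.le_succ _)]
    simp
  have htotal : ∀ K, ((l K).map fun y => g (F.vert y)).sum = 0 := by
    intro K
    have := List.sum_map_eq_sum_count_mul g ((l K).map F.vert)
    rw [List.map_map] at this
    refine this.trans (Finset.sum_eq_zero fun w _ => ?_)
    rcases count_vertices hF (hl K) w with h | h <;> rw [h]
    · simp
    · rw [show ((2 : ℕ) : ZMod 2) = 0 from rfl, zero_mul]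
  have hSturn : ∀ x, Q.Fwd x → S (Q.turn (F.opp x)) = S x + g (F.vert (F.opp x)) := by
    intro x hx
    obtain ⟨K, hK⟩ : ∃ K, F.component (F.vert x) = K := ⟨_, rfl⟩
    have hxl : x ∈ l K := (mem_iff_of_steps_eq (hl K)).2 ⟨hK, hx⟩
    obtain ⟨y, hy⟩ : ∃ y, Q.turn (F.opp x) = y := ⟨_, rfl⟩
    have hyv : F.vert (F.opp x) = F.vert y := by rw [← hy, Q.vert_turn]
    obtain ⟨A, R, e⟩ := List.append_of_mem hxl
    have hch := C.chain_turn K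
    have hrot : (C.circuit K).steps = ((x :: (R ++ A) : List H) : Cycle H) := by
      rw [hl K, e, Cycle.coe_eq_coe, ← List.cons_append]
      exact List.isRotated_append
    rw [hrot, Cycle.chain_coe_cons, ← hQ] at hch
    have ht := htotal K
    rw [e] at ht
    rw [hy, hyv, hS e]
    cases R with
    | cons z R =>
      obtain rfl : y = z := hy.symm.trans (List.isChain_cons_cons.1 hch).1
      rw [hS (K := K) (A := A ++ [x]) (x := y) (R := R) (by rw [e]; simp)]
      simp
    | nil =>
      -- the successor of the last half-edge of the list is the first one
      cases A with
      | nil =>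
        obtain rfl : y = x := hy.symm.trans (List.isChain_cons_cons.1 hch).1
        simp only [List.nil_append, List.map_cons, List.map_nil, List.sum_cons, List.sum_nil,
          add_zero] at ht
        rw [hS e]
        simp [ht]
      | cons z A =>
        obtain rfl : y = z := hy.symm.trans (List.isChain_cons_cons.1 hch).1
        rw [hS (K := K) (A := []) (x := y) (R := A ++ [x]) (by rw [e]; simp)]
        simp only [List.map_append, List.sum_append, List.map_cons, List.map_nil, List.sum_cons,
          List.sum_nil, add_zero, zero_add] at ht ⊢
        rw [ht, zero_add]
  let f : H → ZMod 2 := fun h => if Q.Fwd h then S h else S (F.opp h)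
  have hf : ∀ {h}, Q.Fwd h → f h = S h := fun h => if_pos h
  have hfopp : ∀ h, f (F.opp h) = f h := by
    intro h
    simp only [f, Q.fwd_opp, F.opp_opp, ite_not]
  have hfturn : ∀ h, ¬ Q.Fwd h → f (Q.turn h) = f h + g (F.vert h) := by
    intro h hh
    have h1 : Q.Fwd (F.opp h) := Q.fwd_opp.2 hh
    have := hSturn _ h1
    rw [F.opp_opp] at this
    rw [← hfopp h, hf h1, hf (Q.fwd_turn.2 hh), this]
  refine ⟨f, hfopp, fun h => ?_, fun v => ?_⟩
  · by_cases hh : Q.Fwd h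
    · have := hfturn (Q.turn h) (by rw [Q.fwd_turn]; tauto)
      rw [Q.turn_turn, Q.vert_turn] at this
      rw [this, add_assoc, CharTwo.add_self_eq_zero, add_zero]
    · exact hfturn h hh
  · obtain ⟨A, b, B, b', E, e, hb, hb', hA, hB, hE⟩ := exists_split hF v (hl _)
    refine ⟨A, b, B, b', E, e ▸ hl _, hb, hb', hA, hB, hE, ?_⟩
    have h1 := ((mem_iff_of_steps_eq (hl (F.component v)) (h := b)).1 (by simp [e])).2
    have h2 := ((mem_iff_of_steps_eq (hl (F.component v)) (h := b')).1 (by simp [e])).2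
    have e' : l (F.component v) = (A ++ b :: B) ++ b' :: E := by rw [e]; simp
    rw [hf h1, hf h2, hS e, hS e', hb']
    simp [Function.comp_def, add_assoc]

/-- Over `GF(2)`, the kernel of the modified interlacement matrix consists of coboundaries of the
touch-graph. -/
theorem ker_modifiedInterlacementMatrix_le [Fintype V] [DecidableEq V] (hF : F.IsFourRegular)
    (C : F.EulerSystem) (P : F.CircuitPartition) (D : P.touchGraph.DirectedVersion) :
    LinearMap.ker (C.modifiedInterlacementMatrix P).mulVecLin ≤
      LinearMap.range (CircuitPartition.coboundary (ZMod 2) D).mulVecLin := by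
  classical
  intro x hx
  rw [LinearMap.mem_ker, Matrix.mulVecLin_apply] at hx
  set Q := C.toCircuitPartition with hQ
  let g : V → ZMod 2 := fun w => if P.transition w = C.phi w then 0 else x w
  obtain ⟨f, hopp, hturn, hsplit⟩ := C.exists_potential hF g
  have local_cond : ∀ v, (∀ h, F.vert h = v → f (P.turn h) = f h) ∧
      ∃ h k, F.vert h = v ∧ F.vert k = v ∧ k ≠ h ∧ k ≠ P.turn h ∧ f k = f h + x v := by
    intro v
    obtain ⟨A, b, B, b', E, hl, hb, hb', hA, hB, hE, hf⟩ := hsplit v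
    have hbf := ((EulerSystem.mem_iff_of_steps_eq hl (h := b)).1 (by simp)).2
    have hbf' := ((EulerSystem.mem_iff_of_steps_eq hl (h := b')).1 (by simp)).2
    have hne : b' ≠ b := by
      rintro rfl
      have hn := EulerSystem.nodup_of_steps_eq hl
      simp [List.nodup_append] at hn
    have hnt : b' ≠ Q.turn b := by rintro rfl; rw [Q.fwd_turn] at hbf'; tauto
    -- the `v` coordinate of the equation `M x = 0`
    have hrow : ((B.map F.vert).map g).sum +
        (if b ≠ P.turn (Q.turn b') then x v else 0) = 0 := by
      have h1 := congrFun hx v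
      refine Eq.trans ?_ h1
      rw [List.sum_map_eq_sum_count_mul]
      simp only [Matrix.mulVec, dotProduct,
        EulerSystem.modifiedInterlacementMatrix_apply hF P hl hb hb' hA hB hE, add_mul,
        Finset.sum_add_distrib, ← hQ]
      congr 1
      · refine Finset.sum_congr rfl fun w _ => ?_
        simp only [g]
        split_ifs <;> simp
      · by_cases h : b ≠ P.turn (Q.turn b')
        · simp [h]
        · simp only [h, if_false, and_false, zero_mul, Finset.sum_const_zero]
    have hfib := fun {z} => Q.fiber_subset hF (x := b) (y := b') (z := z) (by rw [hb, hb']) hne hnt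
    rw [hb] at hfib
    -- the four half-edges at `v`; the Euler circuit passes along `a`, `b` and along `a'`, `b'`
    obtain ⟨a, ha⟩ : ∃ a, Q.turn b = a := ⟨_, rfl⟩
    obtain ⟨a', ha'⟩ : ∃ a', Q.turn b' = a' := ⟨_, rfl⟩
    have hav : F.vert a = v := by rw [← ha, Q.vert_turn, hb]
    have hav' : F.vert a' = v := by rw [← ha', Q.vert_turn, hb']
    have hphi := C.transition_eq_phi_iff hF P (x := a')
    rw [hav', ← hQ, ← ha', Q.turn_turn, ha'] at hphi
    have hfa := hturn b
    have hfa' := hturn b'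
    rw [hb, ← hQ, ha] at hfa
    rw [hb', ← hQ, ha'] at hfa'
    rw [ha'] at hrow
    rw [ha] at hnt
    simp only [ha, ha'] at hfib
    have hab : a ≠ b := ha ▸ Q.turn_ne b
    have hab' : a' ≠ b' := ha' ▸ Q.turn_ne b'
    have hba' : a' ≠ b := fun e => hnt (by rw [← ha, ← e, ← ha', Q.turn_turn])
    have haa' : a' ≠ a := fun e => hne (by rw [← Q.turn_turn b', ha', e, ← ha, Q.turn_turn])
    have htt := P.turn_turn
    have htn := P.turn_ne
    have htv := P.vert_turn
    have hx2 := CharTwo.add_self_eq_zero (x v)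
    have hg : g v = if P.turn a' = b' then 0 else x v := by simp only [g, hphi]
    have hb1 := hfib (z := P.turn b) (by rw [htv, hb])
    rcases hfib (z := P.turn a') (by rw [htv, hav']) with e | e | e | e
    · -- `P(v) = χ(v)`
      have e1 : P.turn b = a' := by rw [← e, htt]
      have e2 : P.turn b' = a := by
        have := hfib (z := P.turn b') (by rw [htv, hb'])
        grind
      have e3 : P.turn a = b' := by rw [← e2, htt]
      refine ⟨fun h hh => ?_, b, b', hb, hb', hne, by grind, by grind⟩
      rcases hfib hh with rfl | rfl | rfl | rfl <;> grind
    · -- `P(v) = ψ(v)`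
      have e1 : P.turn a = a' := by rw [← e, htt]
      have e2 : P.turn b = b' := by grind
      have e3 : P.turn b' = b := by rw [← e2, htt]
      refine ⟨fun h hh => ?_, b, a', hb, hav', hba', by grind, by grind⟩
      rcases hfib hh with rfl | rfl | rfl | rfl <;> grind
    · -- `P(v) = φ(v)`
      have e1 : P.turn b' = a' := by rw [← e, htt]
      have e2 : P.turn b = a := by grind
      have e3 : P.turn a = b := by rw [← e2, htt]
      refine ⟨fun h hh => ?_, b, b', hb, hb', hne, by grind, by grind⟩
      rcases hfib hh with rfl | rfl | rfl | rfl <;> grind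
    · exact (htn _ e).elim
  have hpair : ∀ h, f (P.turn h) = f h := fun h => (local_cond _).1 h rfl
  choose s hs using fun γ : P.circuits => P.exists_circ_eq γ.2
  refine ⟨fun γ => f (s γ), ?_⟩
  have hp : ∀ γ h, γ = P.circ h → ∀ hγ : γ ∈ P.circuits, f (s ⟨γ, hγ⟩) = f h := by
    rintro γ h rfl hγ
    exact P.eq_of_circ_eq hopp hpair (hs _)
  funext v
  rw [Matrix.mulVecLin_apply, CircuitPartition.coboundary_mulVec hF]
  obtain ⟨-, h, k, rfl, hk, h1, h2, hfk⟩ := local_cond v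
  rcases CircuitPartition.ends_eq hF D hk h1 h2 with ⟨e1, e2⟩ | ⟨e1, e2⟩ <;>
    rw [hp _ _ e1, hp _ _ e2, hfk, CharTwo.sub_eq_add] <;>
    generalize f h = c <;> generalize x (F.vert h) = d <;> revert c d <;> decide

end HalfEdgeGraph

/-! ### Integer lifts and the cycle space -/

theorem mainTheorem1 {V H : Type*} [Fintype V] [DecidableEq V] [DecidableEq H]
    (F : HalfEdgeGraph V H) (hF : F.IsFourRegular)
    (C : F.EulerSystem) (P : F.CircuitPartition) (D : P.touchGraph.DirectedVersion) :
    (∃ M : Matrix V V ℤ,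
      M.map (Int.cast : ℤ → ZMod 2) = C.modifiedInterlacementMatrix P ∧
      Submodule.span ℝ (Set.range (M.map (Int.cast : ℤ → ℝ)).row) = D.cycleSpace ℝ) ∧
    (∀ M : Matrix V V ℤ,
      M.map (Int.cast : ℤ → ZMod 2) = C.modifiedInterlacementMatrix P →
      Submodule.span ℝ (Set.range (M.map (Int.cast : ℤ → ℝ)).row) = D.cycleSpace ℝ →
      (Module.finrank ℝ (LinearMap.ker (M.map (Int.cast : ℤ → ℝ)).mulVecLin) : ℤ) =
        (P.circuits.card : ℤ) - (F.numComponents : ℤ)) := by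
  have hZ := HalfEdgeGraph.CircuitPartition.finrank_cycleSpace_add_rank_coboundary_le (K := ℝ) D
  have hδ := HalfEdgeGraph.CircuitPartition.rank_coboundary_add_numComponents (K := ℝ) hF D
  have hδ2 := HalfEdgeGraph.CircuitPartition.rank_coboundary_add_numComponents (K := ZMod 2) hF D
  have hker := Submodule.finrank_mono (HalfEdgeGraph.ker_modifiedInterlacementMatrix_le hF C P D)
  have hnull := LinearMap.finrank_range_add_finrank_ker (C.modifiedInterlacementMatrix P).mulVecLin
  rw [Module.finrank_fintype_fun_eq_card] at hnull
  -- the nullity of a lift is at most its nullity modulo `2`, hence at most `|P| - c(F)`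
  have hlower : ∀ M : Matrix V V ℤ,
      M.map (Int.cast : ℤ → ZMod 2) = C.modifiedInterlacementMatrix P →
      Fintype.card V ≤ (M.map (Int.cast : ℤ → ℝ)).rank +
        (HalfEdgeGraph.CircuitPartition.coboundary ℝ D).rank := by
    intro M hM
    have h1 := Matrix.rank_map_zmod_le (K := ℝ) 2 M
    rw [hM] at h1
    rw [Matrix.rank] at h1 hδ2
    omega
  refine ⟨?_, ?_⟩
  · choose W hW hWM using HalfEdgeGraph.exists_closedWalk hF C P D
    let M : Matrix V V ℤ := fun v w =>
      ((W v).count (w, true) : ℤ) - ((W v).count (w, false) : ℤ)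
    have hM : M.map (Int.cast : ℤ → ZMod 2) = C.modifiedInterlacementMatrix P := by
      ext v w
      exact hWM v w
    refine ⟨M, hM, ?_⟩
    have hle : Submodule.span ℝ (Set.range (M.map (Int.cast : ℤ → ℝ)).row) ≤ D.cycleSpace ℝ := by
      rw [Submodule.span_le]
      rintro _ ⟨v, rfl⟩
      refine Submodule.subset_span ⟨W v, hW v, ?_⟩
      funext w
      change ((((W v).count (w, true) : ℤ) - ((W v).count (w, false) : ℤ) : ℤ) : ℝ) = _
      simp [Graph.walkVector]
    refine Submodule.eq_of_le_of_finrank_le hle ?_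
    rw [← Matrix.rank_eq_finrank_span_row]
    have := hlower M hM
    omega
  · intro M hM hspan
    have h1 := hlower M hM
    have h2 := LinearMap.finrank_range_add_finrank_ker (M.map (Int.cast : ℤ → ℝ)).mulVecLin
    rw [Module.finrank_fintype_fun_eq_card] at h2
    rw [← hspan, ← Matrix.rank_eq_finrank_span_row] at hZ
    rw [Matrix.rank] at h1 hZ
    omega
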